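/- Let $K$ be a complete discrete valuation field of characteristic $0$ with normalized valuation $v_K:K\twoheadrightarrow\mathbb Z\cup\{\infty\}$, let $q\in K$ with $0<v_K(q)<\infty$, and let $\mathbb K$ be an algebraic closure of $K$ with the valuation $v:\mathbb K\to\mathbb Q\cup\{\infty\}$ extending $\frac1{v_K(q)}v_K$, so that $v(q)=1$. Put $\epsilon=\prod_{n\ge1}(1+q^n)$ and $\bar\epsilon=\prod_{n\ge1}(1+(-q)^n)$ in $K$. For $r,s\in\mathbb K$ with $\epsilon r\ne\bar\epsilon s$ let $$f_{r,s}(x,y)=d_{12}(x+y)+d_{34}(x^2+y^2)+d_5xy+d_{67}(x^2y+y^2x)+d_8x^2y^2,$$ where $$\begin{aligned} d_{12}&=2\epsilon\bar\epsilon(\epsilon^4-\bar\epsilon^4)(\bar\epsilon s-\epsilon r),\\ d_{34}&=(\epsilon^4-\bar\epsilon^4)(\bar\epsilon^2s^2-\epsilon^2r^2),\\ d_5&=8\epsilon\bar\epsilon(\epsilon r-\bar\epsilon s)(\bar\epsilon^3r-\epsilon^3s),\\ d_{67}&=2(\epsilon r-\bar\epsilon s)\{(\bar\epsilon^4-\epsilon^4)rs+2\epsilon\bar\epsilon(\bar\epsilon^2r^2-\epsilon^2s^2)\},\\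 d_8&=2(\epsilon^2s^2-\bar\epsilon^2r^2)(\bar\epsilon^2s^2-\epsilon^2r^2). \end{aligned}$$ Let $\mathrm{trop}(f_{r,s}):\mathbb R^2\to\mathbb R$ be the function sending $(X,Y)$ to the minimum of $v(c_{ij})+iX+jY$ over the monomials $c_{ij}x^iy^j$ of $f_{r,s}$ with $c_{ij}\neq0$, and let $C(\mathrm{trop}(f_{r,s}))$ be the tropical curve consisting of the points where it is not differentiable. The curve is called smooth if the dual regular subdivision of the Newton polygon of $f_{r,s}$ is a unimodular triangulation, i.e. its two-dimensional cells are lattice triangles of area $\frac12$ and its one-dimensional cells are primitive lattice segments. Put $\delta=v(r+s)-v(r-s)\in\mathbb Q\cup\{\pm\infty\}$. Then for all $r,s\in\mathbb K$ with $\epsilon r\neq\bar\epsilon s$: (i) If $\delta\ge2$, then $C(\mathrm{trop}(f_{r,s}))$ is not smooth. (ii) If $1<\delta<2$, then $C(\mathrm{trop}(f_{r,s}))$ is smooth. (iii) If $\delta=1$, then $C(\mathrm{trop}(f_{r,s}))$ is smooth if and only if $r+s=q\,(r-s)(-1+\kappa)$ for some $\kappa\in\mathbb K$ with $v(\kappa)>0$.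 In particular, suppose that $\delta=1$, that the residue characteristic of $K$ is not $2$, and that $r-s$ has principal coefficient $2$, i.e. $r-s=q^{v(r-s)}(2+\kappa')$ with $v(\kappa')>0$, where $q^{v(r-s)}$ is a chosen rational power of $q$ in $\mathbb K$. Then $C(\mathrm{trop}(f_{r,s}))$ is smooth if and only if the principal coefficient of $r+s$ is $-2$, i.e. $r+s=q^{v(r+s)}(-2+\kappa)$ for some $\kappa\in\mathbb K$ with $v(\kappa)>0$, where $q^{v(r+s)}=q\cdot q^{v(r-s)}$. (iv) If $\delta<1$, then $C(\mathrm{trop}(f_{r,s}))$ is not smooth. Moreover, both cases of (iii) occur: there are $r,s\in\mathbb K$ with $\epsilon r\ne\bar\epsilon s$ and $\delta=1$ for which the curve is smooth, and there are such $r,s$ for which it is not smooth. -/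

import Mathlib

open scoped WithZero

noncomputable section

namespace TropicalEdwards

/-- The Euler product `ε(q) = ∏_{n ≥ 1} (1 + q ^ n)`, as an infinite product in a topological field.
It converges when `q` lies in the maximal ideal of a complete discretely valued field.
The companion quantity `ε̄(q)` is `eulerProd (-q)`. -/
def eulerProd {K : Type*} [Field K] [TopologicalSpace K] (q : K) : K :=
  ∏' n : ℕ, (1 + q ^ (n + 1))

section Polynomial

variable {F : Type*} [Field F]

/-! The coefficients of the family, as functions of `e = ε`, `e' = ε̄` and of the parameters. -/

def d12 (e e' r s : F) : F := 2 * e * e' * (e ^ 4 - e' ^ 4) * (e' * s - e * r)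

def d34 (e e' r s : F) : F := (e ^ 4 - e' ^ 4) * (e' ^ 2 * s ^ 2 - e ^ 2 * r ^ 2)

def d5 (e e' r s : F) : F := 8 * e * e' * (e * r - e' * s) * (e' ^ 3 * r - e ^ 3 * s)

def d67 (e e' r s : F) : F :=
  2 * (e * r - e' * s) *
    ((e' ^ 4 - e ^ 4) * (r * s) + 2 * e * e' * (e' ^ 2 * r ^ 2 - e ^ 2 * s ^ 2))

def d8 (e e' r s : F) : F :=
  2 * (e ^ 2 * s ^ 2 - e' ^ 2 * r ^ 2) * (e' ^ 2 * s ^ 2 - e ^ 2 * r ^ 2)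

open MvPolynomial in
/-- `d₁₂ (x + y) + d₃₄ (x² + y²) + d₅ x y + d₆₇ (x² y + y² x) + d₈ x² y²`,
with `x = X 0` and `y = X 1`. -/
def edwardsPoly (e e' r s : F) : MvPolynomial (Fin 2) F :=
  C (d12 e e' r s) * (X 0 + X 1) + C (d34 e e' r s) * (X 0 ^ 2 + X 1 ^ 2)
    + C (d5 e e' r s) * (X 0 * X 1)
    + C (d67 e e' r s) * (X 0 ^ 2 * X 1 + X 1 ^ 2 * X 0)
    + C (d8 e e' r s) * (X 0 ^ 2 * X 1 ^ 2)

end Polynomial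

/-- The polynomial `f_{r,s}` attached to `q ∈ K` and to `r, s` in the extension `L` of `K`. -/
def curvePoly {K L : Type*} [Field K] [TopologicalSpace K] [Field L] [Algebra K L]
    (q : K) (r s : L) : MvPolynomial (Fin 2) L :=
  edwardsPoly (algebraMap K L (eulerProd q)) (algebraMap K L (eulerProd (-q))) r s

/-- The non-degeneracy condition `ε r ≠ ε̄ s`. -/
def Nondegenerate {K L : Type*} [Field K] [TopologicalSpace K] [Field L] [Algebra K L]
    (q : K) (r s : L) : Prop :=
  algebraMap K L (eulerProd q) * r ≠ algebraMap K L (eulerProd (-q)) * s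

section Tropical

variable {F : Type*} [Field F] (v : AddValuation F (WithTop ℚ)) (p : MvPolynomial (Fin 2) F)

/-- The affine function `(X, Y) ↦ v(c) + i X + j Y` on the plane attached to the monomial
`c xⁱ yʲ` of `p`, where `m = (i, j)`. It is used only for `m` in the support of `p`, where
`v(c)` is finite. -/
def monomialForm (m : Fin 2 →₀ ℕ) (P : ℝ × ℝ) : ℝ :=
  (((v (p.coeff m)).untopD 0 : ℚ) : ℝ) + (m 0 : ℝ) * P.1 + (m 1 : ℝ) * P.2

/-- The tropical polynomial `trop(p)`: the minimum of the affine functions of the monomials of `p`.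
Monomials with coefficient zero (valuation `∞`) do not contribute. -/
def trop (P : ℝ × ℝ) : ℝ := ⨅ m : p.support, monomialForm v p m P

/-- The tropical curve `C(trop(p))`: the points at which `trop(p)` is not differentiable. -/
def tropicalCurve : Set (ℝ × ℝ) := {P | ¬ DifferentiableAt ℝ (trop v p) P}

/-- The exponents of `p` at which the minimum `trop(p)(P)` is attained. -/
def minimalExponents (P : ℝ × ℝ) : Set (Fin 2 →₀ ℕ) :=
  {m | m ∈ p.support ∧ monomialForm v p m P = trop v p P}

/-- The cell dual to `P` in the regular subdivision of the Newton polygon of `p` induced by the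
valuations of the coefficients. -/
def dualCell (P : ℝ × ℝ) : Set (ℝ × ℝ) :=
  convexHull ℝ ((fun m : Fin 2 →₀ ℕ => ((m 0 : ℝ), (m 1 : ℝ))) '' minimalExponents v p P)

/-- A lattice point, seen in the real plane. -/
def latticePt (a : ℤ × ℤ) : ℝ × ℝ := ((a.1 : ℝ), (a.2 : ℝ))

/-- A segment joining two lattice points, of lattice length `1`. -/
def IsPrimitiveSegment (S : Set (ℝ × ℝ)) : Prop :=
  ∃ a b : ℤ × ℤ, Int.gcd (b.1 - a.1) (b.2 - a.2) = 1 ∧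
    S = convexHull ℝ {latticePt a, latticePt b}

/-- A triangle with lattice vertices and area `1/2`
(the area of the triangle `a b c` is `|det (b - a, c - a)| / 2`). -/
def IsUnimodularTriangle (S : Set (ℝ × ℝ)) : Prop :=
  ∃ a b c : ℤ × ℤ,
    |(b.1 - a.1) * (c.2 - a.2) - (b.2 - a.2) * (c.1 - a.1)| = 1 ∧
    S = convexHull ℝ {latticePt a, latticePt b, latticePt c}

/-- The tropical curve `C(trop(p))` is smooth: the dual subdivision of the Newton polygon is a
unimodular triangulation. That is, points in the relative interior of the edges of the curve are
dual to primitive lattice segments, and its vertices are dual to lattice triangles of area `1/2`. -/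
def IsTropicallySmooth : Prop :=
  ∀ P ∈ tropicalCurve v p,
    IsPrimitiveSegment (dualCell v p P) ∨ IsUnimodularTriangle (dualCell v p P)

/-- The inclusion of `ℚ ∪ {∞}` in the extended reals. -/
def toEReal (x : WithTop ℚ) : EReal := x.recTopCoe ⊤ (fun t => (((t : ℚ) : ℝ) : EReal))

/-- `δ = v(r + s) - v(r - s)`. It is `+∞` when `r + s = 0 ≠ r - s` and `-∞` when
`r - s = 0 ≠ r + s`; both terms are infinite only for `r = s = 0`, when `2 ≠ 0`. -/
def delta (r s : F) : EReal := toEReal (v (r + s)) - toEReal (v (r - s))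

end Tropical

/-- `v` is the valuation of `L ⊇ K` normalized by `v(q) = 1`: it extends `v_K / v_K(q)`, where
`v_K(x) = - log (Valued.v x) ∈ ℤ` is the additive form of the valuation of `K`. -/
def ExtendsNormalized {K L : Type*} [Field K] [Valued K ℤᵐ⁰] [Field L] [Algebra K L]
    (q : K) (v : AddValuation L (WithTop ℚ)) : Prop :=
  ∀ x : K, x ≠ 0 → v (algebraMap K L x) =
    ((((-WithZero.log (Valued.v x) : ℤ) : ℚ) / ((-WithZero.log (Valued.v q) : ℤ) : ℚ) : ℚ) :
      WithTop ℚ)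

end TropicalEdwards

end

open scoped WithZero

noncomputable section

namespace TropicalEdwards

/-! ### Even and odd parts of the Euler product -/

section EulerProduct

variable {K : Type*} [Field K] [Valued K ℤᵐ⁰]

open Filter Topology Valuation MonoidWithZeroHom

/-! Split `ε = A + B` and `ε̄ = A - B` into even and odd parts in `q`. Then `A = 1 + O(q)` and `B =
q + O(q²)`, and this is all that is needed about the Euler product (`exists_isFirstOrder`). Put `M =
r - s`, `P = r + s`, with valuations `m` and `p`, so that `δ = p - m`. All coefficients share the
factor `2(εr - ε̄s) = 2(AM + BP)`, which is nonzero by nondegeneracy, and the remaining powers of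
`2` contribute a function affine in the exponent. Neither affects the dual subdivision, so the
residue characteristic plays no role. The remaining heights of `d₁₂, d₃₄, d₅, d₆₇, d₈` are, in the
range `1 < δ < 2`, the numbers `1, m + 2, m, m + p, 3m + 2`; in general the decisive factor is `AP +
BM`, whose leading part is `(r + s) + q(r - s)`.

For `δ ≥ 2` the height at `(2,1)` is not below the segment from `(2,0)` to `(2,2)`, so an edge of
lattice length two survives. For `1 < δ < 2` it is below, and the subdivision is the star from
`(1,1)`. For `-1 < δ ≤ 1` the square `(1,0), (2,0), (2,1), (1,1)` stays uncut exactly when `v(AP +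
BM) = p`. This always holds for `δ < 1`; for `δ = 1` it fails precisely when `r + s ≡ -q(r - s)` to
leading order, and then the square is cut by a diagonal. For `δ ≤ -1` a trapezoid of four exponents
lies in one cell.

Combinatorially, the vertices of a cell are the exponents whose forms are simultaneously minimal at
a point. Smoothness follows by excluding the pairs that are not edges and checking the cliques of
the remaining graph (`isTropicallySmooth_of_missing`). Non-smoothness follows by exhibiting a point
whose cell contains four lattice points (`not_isTropicallySmooth_of_four`). -/

theorem nonempty_rankOne_of_lt_one {q : K} (hq0 : q ≠ 0) (hq1 : Valued.v q < 1) :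
    Nonempty (Valued.v : Valuation K ℤᵐ⁰).RankOne := by
  have : (Valued.v : Valuation K ℤᵐ⁰).IsNontrivial :=
    ⟨q, (Valuation.ne_zero_iff _).2 hq0, hq1.ne⟩
  rw [nonempty_rankOne_iff_mulArchimedean]
  exact MulArchimedean.comap
    (ValueGroup₀.embedding (f := .ofClass (Valued.v : Valuation K ℤᵐ⁰))).toMonoidHom
    ValueGroup₀.embedding_strictMono

open scoped Valued in
theorem multipliable_one_add_pow [CompleteSpace K] {q : K} (hq0 : q ≠ 0) (hq1 : Valued.v q < 1) :
    Multipliable fun n : ℕ => 1 + q ^ (n + 1) := by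
  -- Rank one turns the valuation into a real norm, so comparison with a geometric series applies.
  obtain ⟨hr⟩ := nonempty_rankOne_of_lt_one hq0 hq1
  let := hr
  have hq : ‖q‖ < 1 := Valued.toNormedField.norm_lt_one_iff.2 hq1
  refine multipliable_one_add_of_summable (f := fun n : ℕ => q ^ (n + 1)) ?_
  simp_rw [norm_pow]
  exact (summable_nat_add_iff 1).2 (summable_geometric_of_lt_one (norm_nonneg _) hq)

theorem tendsto_eulerProd [CompleteSpace K] {q : K} (hq0 : q ≠ 0) (hq1 : Valued.v q < 1) :
    Tendsto (fun n => ∏ i ∈ Finset.range n, (1 + q ^ (i + 1))) atTop (𝓝 (eulerProd q)) :=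
  (multipliable_one_add_pow hq0 hq1).hasProd.tendsto_prod_nat

/-- The partial products of `eulerProd (± q)` have the form `a ± b` with `a` close to `1`
and `b` close to `q`. -/
theorem exists_partial_prod_eq {q : K} (hq1 : Valued.v q < 1) (n : ℕ) :
    ∃ a b : K, Valued.v (a - 1) ≤ Valued.v q ∧ Valued.v (b - q) ≤ Valued.v (q ^ 2) ∧
      ∏ i ∈ Finset.range (n + 1), (1 + q ^ (i + 1)) = a + b ∧
      ∏ i ∈ Finset.range (n + 1), (1 + (-q) ^ (i + 1)) = a - b := by
  induction n with
  | zero => exact ⟨1, q, by simp, by simp, by simp, by simp [sub_eq_add_neg]⟩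
  | succ n ih =>
    obtain ⟨a, b, ha, hb, h₁, h₂⟩ := ih
    have hva : Valued.v a ≤ 1 := by
      rw [← sub_add_cancel a 1]
      exact (Valuation.map_add_le _ (ha.trans hq1.le) (map_one _).le)
    have hq2 : Valued.v (q ^ 2) ≤ Valued.v q := by
      rw [map_pow, pow_two]
      exact mul_le_of_le_one_left' hq1.le
    have hvb : Valued.v b ≤ 1 := by
      rw [← sub_add_cancel b q]
      exact (Valuation.map_add_le _ (hb.trans (hq2.trans hq1.le)) hq1.le)
    have hk : Valued.v (q ^ (n + 2)) ≤ Valued.v (q ^ 2) := by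
      rw [pow_add, map_mul, map_pow _ q n]
      exact mul_le_of_le_one_left' (pow_le_one' hq1.le n)
    have key : ∀ {c d e : K} {g : ℤᵐ⁰}, Valued.v (c - e) ≤ g → Valued.v d ≤ 1 →
        Valued.v (q ^ 2) ≤ g → Valued.v (c + q ^ (n + 2) * d - e) ≤ g := by
      intro c d e g hc hd hg
      rw [add_sub_right_comm]
      refine Valuation.map_add_le _ hc ?_
      rw [map_mul]
      exact (mul_le_of_le_one_right' hd).trans (hk.trans hg)
    rw [Finset.prod_range_succ, h₁, Finset.prod_range_succ (fun i => 1 + (-q) ^ (i + 1)), h₂]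
    -- The new factors are `1 ± q ^ (n + 2)`, with equal signs for even exponents and opposite signs
    -- for odd ones; in the odd case the increments of `a` and `b` are exchanged.
    rcases Nat.even_or_odd (n + 2) with hn | hn
    · refine ⟨a + q ^ (n + 2) * a, b + q ^ (n + 2) * b, key ha hva hq2, key hb hvb le_rfl, by ring,
        ?_⟩
      rw [hn.neg_pow]
      ring
    · refine ⟨a + q ^ (n + 2) * b, b + q ^ (n + 2) * a, key ha hvb hq2, key hb hva le_rfl, by ring,
        ?_⟩
      rw [hn.neg_pow]
      ring

theorem eventually_valued_eq {x : ℕ → K} {a : K} (h : Tendsto x atTop (𝓝 a)) (ha : a ≠ 0) :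
    ∀ᶠ n in atTop, Valued.v (x n) = Valued.v a :=
  h.eventually (Valued.locally_const ((Valuation.ne_zero_iff _).2 ha))

/-- The valuation is locally constant away from `0`, so a nonzero limit has the valuation of some
term of the sequence. -/
theorem valued_le_of_tendsto {x : ℕ → K} {a : K} {g : ℤᵐ⁰} (h : Tendsto x atTop (𝓝 a))
    (hx : ∀ n, Valued.v (x n) ≤ g) : Valued.v a ≤ g := by
  rcases eq_or_ne a 0 with rfl | ha
  · simp
  · obtain ⟨n, hn⟩ := (eventually_valued_eq h ha).exists
    exact hn ▸ hx n

/-- `ε(± q) = a ± b` with `a` close to `1` and `b` close to `q`. -/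
theorem exists_eulerProd_eq [CharZero K] [CompleteSpace K] {q : K} (hq0 : q ≠ 0)
    (hq1 : Valued.v q < 1) :
    ∃ a b : K, Valued.v (a - 1) ≤ Valued.v q ∧ Valued.v (b - q) ≤ Valued.v (q ^ 2) ∧
      eulerProd q = a + b ∧ eulerProd (-q) = a - b := by
  have t₁ := (tendsto_eulerProd hq0 hq1).comp (tendsto_add_atTop_nat 1)
  have t₂ := (tendsto_eulerProd (neg_ne_zero.2 hq0) (by rwa [Valuation.map_neg])).comp
    (tendsto_add_atTop_nat 1)
  choose a b ha hb h₁ h₂ using exists_partial_prod_eq (q := q) hq1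
  -- Since `2` is invertible, the two parts are recovered from the partial products and therefore
  -- converge.
  have ea : ∀ n, a n = (∏ i ∈ Finset.range (n + 1), (1 + q ^ (i + 1)) +
      ∏ i ∈ Finset.range (n + 1), (1 + (-q) ^ (i + 1))) / 2 := fun n => by
    rw [h₁, h₂]; ring
  have eb : ∀ n, b n = (∏ i ∈ Finset.range (n + 1), (1 + q ^ (i + 1)) -
      ∏ i ∈ Finset.range (n + 1), (1 + (-q) ^ (i + 1))) / 2 := fun n => by
    rw [h₁, h₂]; ring
  have ta : Tendsto a atTop (𝓝 ((eulerProd q + eulerProd (-q)) / 2)) :=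
    ((t₁.add t₂).div_const 2).congr fun n => (ea n).symm
  have tb : Tendsto b atTop (𝓝 ((eulerProd q - eulerProd (-q)) / 2)) :=
    ((t₁.sub t₂).div_const 2).congr fun n => (eb n).symm
  exact ⟨_, _, valued_le_of_tendsto (ta.sub_const 1) ha, valued_le_of_tendsto (tb.sub_const q) hb,
    by ring, by ring⟩

end EulerProduct

/-! ### Points of the tropical curve and ties in the minimum -/

section TropicalCurve

open Filter Topology

variable {F : Type*} [Field F] {v : AddValuation F (WithTop ℚ)} {p : MvPolynomial (Fin 2) F}

theorem trop_le {m : Fin 2 →₀ ℕ} (hm : m ∈ p.support) (P : ℝ × ℝ) :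
    trop v p P ≤ monomialForm v p m P :=
  ciInf_le (f := fun m : p.support => monomialForm v p m P) (Set.finite_range _).bddBelow ⟨m, hm⟩

theorem mem_minimalExponents_iff {m : Fin 2 →₀ ℕ} {P : ℝ × ℝ} :
    m ∈ minimalExponents v p P ↔
      m ∈ p.support ∧ ∀ n ∈ p.support, monomialForm v p m P ≤ monomialForm v p n P := by
  refine ⟨fun h => ⟨h.1, fun n hn => h.2.trans_le (trop_le hn P)⟩, fun h => ⟨h.1, ?_⟩⟩
  have : Nonempty p.support := ⟨⟨m, h.1⟩⟩
  exact le_antisymm (le_ciInf fun n => h.2 n n.2) (trop_le h.1 P)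

theorem minimalExponents_nonempty (hp : p ≠ 0) (P : ℝ × ℝ) : (minimalExponents v p P).Nonempty := by
  obtain ⟨m, hm, h⟩ := p.support.exists_min_image (fun m => monomialForm v p m P)
    (MvPolynomial.support_nonempty.2 hp)
  exact ⟨m, mem_minimalExponents_iff.2 ⟨hm, h⟩⟩

theorem hasFDerivAt_monomialForm (m : Fin 2 →₀ ℕ) (P : ℝ × ℝ) :
    HasFDerivAt (monomialForm v p m)
      ((m 0 : ℝ) • ContinuousLinearMap.fst ℝ ℝ ℝ + (m 1 : ℝ) • ContinuousLinearMap.snd ℝ ℝ ℝ) P := by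
  unfold monomialForm
  exact ((hasFDerivAt_fst.const_mul (m 0 : ℝ)).const_add _).add
    (hasFDerivAt_snd.const_mul (m 1 : ℝ))

/-- A minimal form touches `trop` from above at `P`. If `trop` were differentiable there, every
minimal form would have its gradient, and the gradient of a form is its exponent. -/
theorem mem_tropicalCurve_of_nontrivial {P : ℝ × ℝ} (h : (minimalExponents v p P).Nontrivial) :
    P ∈ tropicalCurve v p := by
  intro hd
  have key : ∀ m ∈ minimalExponents v p P,
      (m 0 : ℝ) • ContinuousLinearMap.fst ℝ ℝ ℝ + (m 1 : ℝ) • ContinuousLinearMap.snd ℝ ℝ ℝ =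
        fderiv ℝ (trop v p) P := by
    intro m hm
    have hmin : IsLocalMin (fun Q => monomialForm v p m Q - trop v p Q) P :=
      Eventually.of_forall fun Q => by
        dsimp only
        rw [hm.2, sub_self]
        exact sub_nonneg.2 (trop_le hm.1 Q)
    exact sub_eq_zero.1
      (hmin.hasFDerivAt_eq_zero ((hasFDerivAt_monomialForm m P).sub hd.hasFDerivAt))
  obtain ⟨m, hm, n, hn, hmn⟩ := h
  have e := (key m hm).trans (key n hn).symm
  have e₀ := DFunLike.congr_fun e (1, 0)
  have e₁ := DFunLike.congr_fun e (0, 1)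
  simp at e₀ e₁
  refine hmn (Finsupp.ext fun i => ?_)
  fin_cases i
  · exact e₀
  · exact e₁

/-- If one form alone is minimal at `P`, the finitely many strict inequalities persist nearby, so
`trop` is affine around `P`. -/
theorem nontrivial_of_mem_tropicalCurve (hp : p ≠ 0) {P : ℝ × ℝ} (h : P ∈ tropicalCurve v p) :
    (minimalExponents v p P).Nontrivial := by
  by_contra hs
  obtain ⟨m, hm⟩ := minimalExponents_nonempty (v := v) hp P
  refine h ?_
  have hlt : ∀ᶠ Q in 𝓝 P, ∀ n ∈ p.support, monomialForm v p m Q ≤ monomialForm v p n Q := by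
    rw [eventually_all_finset]
    intro n hn
    rcases eq_or_ne n m with rfl | hnm
    · exact Eventually.of_forall fun _ => le_rfl
    · have hlt : monomialForm v p m P < monomialForm v p n P := by
        refine lt_of_le_of_ne ((mem_minimalExponents_iff.1 hm).2 n hn) fun he => ?_
        exact hs ⟨n, ⟨hn, he ▸ hm.2⟩, m, hm, hnm⟩
      exact ((hasFDerivAt_monomialForm m P).continuousAt.eventually_lt
        (hasFDerivAt_monomialForm n P).continuousAt hlt).mono fun _ => le_of_lt
  have he : trop v p =ᶠ[𝓝 P] monomialForm v p m := hlt.mono fun Q hQ =>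
    ((mem_minimalExponents_iff.2 ⟨hm.1, hQ⟩).2).symm
  exact ((hasFDerivAt_monomialForm m P).congr_of_eventuallyEq he).differentiableAt

end TropicalCurve

/-! ### Lattice points of primitive segments and unimodular triangles -/

section LatticePolygons

/-- The integral determinant attached to a lattice triangle: twice its signed area. -/
def latticeDet (a b c : ℤ × ℤ) : ℤ := (b.1 - a.1) * (c.2 - a.2) - (b.2 - a.2) * (c.1 - a.1)

/-- Barycentric coordinates are quotients of lattice determinants by the determinant of the
triangle. When the latter is `±1` they are nonnegative integers with sum `1`, so one of them is `1`
and the others vanish. -/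
theorem eq_vertex_of_mem_triangle {a b c z : ℤ × ℤ} (h : |latticeDet a b c| = 1)
    (hz : latticePt z ∈ convexHull ℝ {latticePt a, latticePt b, latticePt c}) :
    z = a ∨ z = b ∨ z = c := by
  rw [convexHull_insert (by simp), convexHull_pair] at hz
  simp only [convexJoin_singleton_left, Set.mem_iUnion, segment, Set.mem_ofPred_eq] at hz
  obtain ⟨w, ⟨s, t, hs, ht, hst, rfl⟩, x, y, hx, hy, hxy, e⟩ := hz
  have e₁ := congrArg Prod.fst e
  have e₂ := congrArg Prod.snd e
  simp [latticePt] at e₁ e₂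
  have hx' : x = 1 - y := by linarith
  subst hx'
  have d₁ : ((latticeDet a z c : ℤ) : ℝ) = y * s * (latticeDet a b c : ℤ) := by
    simp only [latticeDet]; push_cast
    have : t = 1 - s := by linarith
    subst this
    rw [← e₁, ← e₂]; ring
  have d₂ : ((latticeDet a b z : ℤ) : ℝ) = y * t * (latticeDet a b c : ℤ) := by
    simp only [latticeDet]; push_cast
    have : s = 1 - t := by linarith
    subst this
    rw [← e₁, ← e₂]; ring
  obtain ⟨k, hk⟩ : ∃ k : ℤ, (k : ℝ) = y * s := by
    rcases (abs_eq zero_le_one).1 h with h | h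
    · exact ⟨latticeDet a z c, by rw [d₁, h]; simp⟩
    · exact ⟨-latticeDet a z c, by push_cast; rw [d₁, h]; simp⟩
  obtain ⟨l, hl⟩ : ∃ l : ℤ, (l : ℝ) = y * t := by
    rcases (abs_eq zero_le_one).1 h with h | h
    · exact ⟨latticeDet a b z, by rw [d₂, h]; simp⟩
    · exact ⟨-latticeDet a b z, by push_cast; rw [d₂, h]; simp⟩
  have hk0 : 0 ≤ k := by exact_mod_cast hk ▸ mul_nonneg hy hs
  have hl0 : 0 ≤ l := by exact_mod_cast hl ▸ mul_nonneg hy ht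
  have hkly : (k : ℝ) + l = y := by rw [hk, hl, ← mul_add, hst, mul_one]
  have hkl : k + l ≤ 1 := by
    have : (k : ℝ) + l ≤ 1 := by linarith
    exact_mod_cast this
  have f₁ : z.1 = (1 - k - l) * a.1 + k * b.1 + l * c.1 := by
    have : (z.1 : ℝ) = (1 - k - l) * a.1 + k * b.1 + l * c.1 := by
      rw [← e₁, hk, hl]; linear_combination (y * a.1) * hst
    exact_mod_cast this
  have f₂ : z.2 = (1 - k - l) * a.2 + k * b.2 + l * c.2 := by
    have : (z.2 : ℝ) = (1 - k - l) * a.2 + k * b.2 + l * c.2 := by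
      rw [← e₂, hk, hl]; linear_combination (y * a.2) * hst
    exact_mod_cast this
  have : (k = 0 ∧ l = 0) ∨ (k = 1 ∧ l = 0) ∨ (k = 0 ∧ l = 1) := by omega
  rcases this with ⟨rfl, rfl⟩ | ⟨rfl, rfl⟩ | ⟨rfl, rfl⟩
  · exact Or.inl (Prod.ext (by simpa using f₁) (by simpa using f₂))
  · exact Or.inr (Or.inl (Prod.ext (by simpa using f₁) (by simpa using f₂)))
  · exact Or.inr (Or.inr (Prod.ext (by simpa using f₁) (by simpa using f₂)))

theorem eq_vertex_of_mem_segment {a b z : ℤ × ℤ} (h : Int.gcd (b.1 - a.1) (b.2 - a.2) = 1)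
    (hz : latticePt z ∈ convexHull ℝ {latticePt a, latticePt b}) : z = a ∨ z = b := by
  -- complete the segment to a unimodular triangle
  obtain ⟨x, y, hxy⟩ := Int.isCoprime_iff_gcd_eq_one.2 h
  have hc : |latticeDet a b (a.1 - y, a.2 + x)| = 1 := by
    have : latticeDet a b (a.1 - y, a.2 + x) = 1 := by
      simp only [latticeDet]; linear_combination hxy
    rw [this, abs_one]
  have hz' := convexHull_mono (t := {latticePt a, latticePt b, latticePt (a.1 - y, a.2 + x)})
    (by rintro _ (rfl | rfl) <;> simp) hz
  rcases eq_vertex_of_mem_triangle hc hz' with rfl | rfl | rfl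
  · exact Or.inl rfl
  · exact Or.inr rfl
  · rw [convexHull_pair] at hz
    obtain ⟨s, t, -, -, hst, e⟩ := hz
    have e₁ := congrArg Prod.fst e
    have e₂ := congrArg Prod.snd e
    simp [latticePt] at e₁ e₂
    have : s = 1 - t := by linarith
    subst this
    have hxy' : (x : ℝ) * (b.1 - a.1) + y * (b.2 - a.2) = 1 := by exact_mod_cast hxy
    -- The added vertex is off the line through `a` and `b`: were it on that line, the Bézout
    -- combination would vanish instead of being `1`.
    exfalso
    have e₃ : t * (b.1 - a.1) = -(y : ℝ) := by linear_combination e₁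
    have e₄ : t * (b.2 - a.2) = (x : ℝ) := by linear_combination e₂
    have : (x : ℝ) * (b.1 - a.1) + y * (b.2 - a.2) = 0 := by
      rcases eq_or_ne t 0 with rfl | ht
      · have hy : (y : ℝ) = 0 := by linarith
        have hx : (x : ℝ) = 0 := by linarith
        rw [hx, hy]; ring
      · refine mul_left_cancel₀ ht ?_
        linear_combination (x : ℝ) * e₃ + y * e₄
    linarith

/-- A set containing four lattice points is neither a primitive segment nor a unimodular
triangle. -/
theorem not_unimodular_of_four_lattice_points {S : Set (ℝ × ℝ)} {T : Finset (ℤ × ℤ)}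
    (hT : 3 < T.card) (hS : ∀ z ∈ T, latticePt z ∈ S) :
    ¬ (IsPrimitiveSegment S ∨ IsUnimodularTriangle S) := by
  rintro (⟨a, b, h, rfl⟩ | ⟨a, b, c, h, rfl⟩)
  · have : T ⊆ {a, b} := fun z hz => by
      simpa using eq_vertex_of_mem_segment h (hS z hz)
    have := (Finset.card_le_card this).trans Finset.card_le_two
    omega
  · have : T ⊆ {a, b, c} := fun z hz => by
      simpa using eq_vertex_of_mem_triangle h (hS z hz)
    have := (Finset.card_le_card this).trans Finset.card_le_three
    omega

/-- A set of lattice points whose points are pairwise adjacent in the `1`-skeleton of a unimodular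
triangulation spans a cell of the triangulation. -/
theorem unimodular_of_pairwise_adjacent {S : Set (ℤ × ℤ)} (E : Finset (ℤ × ℤ))
    (Adj : ℤ × ℤ → ℤ × ℤ → Prop) (hSE : S ⊆ E) (hS : S.Nontrivial) (hadj : S.Pairwise Adj)
    (h₂ : ∀ a ∈ E, ∀ b ∈ E, a ≠ b → Adj a b → Int.gcd (b.1 - a.1) (b.2 - a.2) = 1)
    (h₃ : ∀ a ∈ E, ∀ b ∈ E, a ≠ b → Adj a b → ∀ c ∈ E, a ≠ c → b ≠ c → Adj a c → Adj b c →
      |latticeDet a b c| = 1 ∧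
        ∀ d ∈ E, a ≠ d → b ≠ d → c ≠ d → ¬ (Adj a d ∧ Adj b d ∧ Adj c d)) :
    IsPrimitiveSegment (convexHull ℝ (latticePt '' S)) ∨
      IsUnimodularTriangle (convexHull ℝ (latticePt '' S)) := by
  obtain ⟨a, ha, b, hb, hab⟩ := hS
  by_cases hS₂ : S ⊆ {a, b}
  · left
    have : S = {a, b} := hS₂.antisymm (by rintro _ (rfl | rfl) <;> assumption)
    exact ⟨a, b, h₂ a (hSE ha) b (hSE hb) hab (hadj ha hb hab), by rw [this, Set.image_pair]⟩
  · right
    obtain ⟨c, hc, hc'⟩ := Set.not_subset.1 hS₂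
    have hac : a ≠ c := fun h => hc' (by simp [h])
    have hbc : b ≠ c := fun h => hc' (by simp [h])
    obtain ⟨hdet, h₄⟩ := h₃ a (hSE ha) b (hSE hb) hab (hadj ha hb hab) c (hSE hc) hac hbc
      (hadj ha hc hac) (hadj hb hc hbc)
    have : S = {a, b, c} := by
      refine Set.Subset.antisymm (fun d hd => ?_) (by rintro _ (rfl | rfl | rfl) <;> assumption)
      by_contra hd'
      have had : a ≠ d := fun h => hd' (by simp [h])
      have hbd : b ≠ d := fun h => hd' (by simp [h])
      have hcd : c ≠ d := fun h => hd' (by simp [h])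
      exact h₄ d (hSE hd) had hbd hcd ⟨hadj ha hd had, hadj hb hd hbd, hadj hc hd hcd⟩
    exact ⟨a, b, c, hdet, by rw [this, Set.image_insert_eq, Set.image_pair]⟩

end LatticePolygons

/-! ### Smoothness criteria for symmetric biquadratic polynomials -/

section SymmetricBiquadratic

variable {F : Type*} [Field F]

/-- The coefficients of the symmetric polynomial
`c₁ (x + y) + c₂ (x² + y²) + c₃ x y + c₄ (x² y + y² x) + c₅ x² y²`. -/
def symCoeff (c₁ c₂ c₃ c₄ c₅ : F) : ℕ → ℕ → F
  | 1, 0 => c₁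
  | 0, 1 => c₁
  | 2, 0 => c₂
  | 0, 2 => c₂
  | 1, 1 => c₃
  | 2, 1 => c₄
  | 1, 2 => c₄
  | 2, 2 => c₅
  | _, _ => 0

/-- The exponent of the monomial `xⁱ yʲ`. -/
def expo (i j : ℕ) : Fin 2 →₀ ℕ := Finsupp.single 0 i + Finsupp.single 1 j

@[simp] theorem expo_zero (i j : ℕ) : expo i j 0 = i := by simp [expo]

@[simp] theorem expo_one (i j : ℕ) : expo i j 1 = j := by simp [expo]

theorem expo_eq_iff {i j : ℕ} {m : Fin 2 →₀ ℕ} : expo i j = m ↔ m 0 = i ∧ m 1 = j := by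
  constructor
  · rintro rfl
    simp
  · rintro ⟨rfl, rfl⟩
    ext k
    fin_cases k <;> simp

/-- The exponents which may occur in a polynomial with coefficients `symCoeff`. -/
def symExponents : Finset (ℕ × ℕ) :=
  {(1, 0), (0, 1), (2, 0), (0, 2), (1, 1), (2, 1), (1, 2), (2, 2)}

theorem symCoeff_eq_zero {c₁ c₂ c₃ c₄ c₅ : F} {i j : ℕ} (h : (i, j) ∉ symExponents) :
    symCoeff c₁ c₂ c₃ c₄ c₅ i j = 0 := by
  unfold symCoeff
  split <;> first | rfl | exact absurd (by decide) h

open MvPolynomial in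
theorem coeff_edwardsPoly (e e' r s : F) (m : Fin 2 →₀ ℕ) :
    (edwardsPoly e e' r s).coeff m =
      symCoeff (d12 e e' r s) (d34 e e' r s) (d5 e e' r s) (d67 e e' r s) (d8 e e' r s)
        (m 0) (m 1) := by
  have key : ∀ i j : ℕ, coeff m ((X 0 : MvPolynomial (Fin 2) F) ^ i * X 1 ^ j) =
      if m 0 = i ∧ m 1 = j then 1 else 0 := by
    intro i j
    have : (X 0 : MvPolynomial (Fin 2) F) ^ i * X 1 ^ j = monomial (expo i j) 1 := by
      rw [X_pow_eq_monomial, X_pow_eq_monomial, monomial_mul, one_mul, expo]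
    rw [this, coeff_monomial]
    simp only [expo_eq_iff]
  have h : edwardsPoly e e' r s =
      C (d12 e e' r s) * (X 0 ^ 1 * X 1 ^ 0 + X 0 ^ 0 * X 1 ^ 1)
        + C (d34 e e' r s) * (X 0 ^ 2 * X 1 ^ 0 + X 0 ^ 0 * X 1 ^ 2)
        + C (d5 e e' r s) * (X 0 ^ 1 * X 1 ^ 1)
        + C (d67 e e' r s) * (X 0 ^ 2 * X 1 ^ 1 + X 0 ^ 1 * X 1 ^ 2)
        + C (d8 e e' r s) * (X 0 ^ 2 * X 1 ^ 2) := by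
    unfold edwardsPoly
    ring
  rw [h]
  simp only [coeff_add, coeff_C_mul, key]
  by_cases hm : (m 0, m 1) ∈ symExponents
  · simp only [symExponents, Finset.mem_insert, Finset.mem_singleton, Prod.mk.injEq] at hm
    rcases hm with h | h | h | h | h | h | h | h <;> simp [h.1, h.2, symCoeff]
  · rw [symCoeff_eq_zero hm]
    simp only [symExponents, Finset.mem_insert, Finset.mem_singleton, Prod.mk.injEq, not_or] at hm
    simp [hm]

/-- The valuation of a nonzero element, as a real number. -/
def realVal (v : AddValuation F (WithTop ℚ)) (c : F) : ℝ := (((v c).untopD 0 : ℚ) : ℝ)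

variable {v : AddValuation F (WithTop ℚ)} {p : MvPolynomial (Fin 2) F} {c₁ c₂ c₃ c₄ c₅ : F}

/-- The lattice points of the cell dual to `P` which come from monomials. -/
def cellVertices (v : AddValuation F (WithTop ℚ)) (p : MvPolynomial (Fin 2) F) (P : ℝ × ℝ) :
    Set (ℤ × ℤ) :=
  (fun m : Fin 2 →₀ ℕ => ((m 0 : ℤ), (m 1 : ℤ))) '' minimalExponents v p P

theorem dualCell_eq (P : ℝ × ℝ) : dualCell v p P = convexHull ℝ (latticePt '' cellVertices v p P) := by
  simp [dualCell, cellVertices, Set.image_image, latticePt]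

theorem exists_mem_symExponents (hp : ∀ m, p.coeff m = symCoeff c₁ c₂ c₃ c₄ c₅ (m 0) (m 1))
    {m : Fin 2 →₀ ℕ} (hm : m ∈ p.support) : (m 0, m 1) ∈ symExponents := by
  by_contra h
  exact MvPolynomial.mem_support_iff.1 hm ((hp m).trans (symCoeff_eq_zero h))

theorem mem_cellVertices (hp : ∀ m, p.coeff m = symCoeff c₁ c₂ c₃ c₄ c₅ (m 0) (m 1))
    {P : ℝ × ℝ} {z : ℤ × ℤ} (hz : z ∈ cellVertices v p P) :
    ∃ i j : ℕ, (i, j) ∈ symExponents ∧ z = (↑i, ↑j) ∧ symCoeff c₁ c₂ c₃ c₄ c₅ i j ≠ 0 ∧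
      realVal v (symCoeff c₁ c₂ c₃ c₄ c₅ i j) + i * P.1 + j * P.2 = trop v p P := by
  obtain ⟨m, hm, rfl⟩ := hz
  refine ⟨m 0, m 1, exists_mem_symExponents hp hm.1, rfl, ?_, ?_⟩
  · rw [← hp]
    exact MvPolynomial.mem_support_iff.1 hm.1
  · rw [← hp]
    exact hm.2

theorem trop_le_symCoeff (hp : ∀ m, p.coeff m = symCoeff c₁ c₂ c₃ c₄ c₅ (m 0) (m 1))
    {i j : ℕ} (h : symCoeff c₁ c₂ c₃ c₄ c₅ i j ≠ 0) (P : ℝ × ℝ) :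
    trop v p P ≤ realVal v (symCoeff c₁ c₂ c₃ c₄ c₅ i j) + i * P.1 + j * P.2 := by
  have hc : p.coeff (expo i j) = symCoeff c₁ c₂ c₃ c₄ c₅ i j := by rw [hp]; simp
  have := trop_le (v := v) (MvPolynomial.mem_support_iff.2 (hc ▸ h)) P
  simpa only [monomialForm, hc, expo_zero, expo_one, realVal] using this

/-- The set `symExponents`, in the lattice `ℤ²`. -/
def latticeExponents : Finset (ℤ × ℤ) :=
  {(1, 0), (0, 1), (2, 0), (0, 2), (1, 1), (2, 1), (1, 2), (2, 2)}

/-- Two lattice points which are not listed as a missing edge. -/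
def NotMissing (bad : Finset ((ℤ × ℤ) × (ℤ × ℤ))) (a b : ℤ × ℤ) : Prop :=
  (a, b) ∉ bad ∧ (b, a) ∉ bad

instance (bad : Finset ((ℤ × ℤ) × (ℤ × ℤ))) (a b : ℤ × ℤ) : Decidable (NotMissing bad a b) :=
  inferInstanceAs (Decidable (_ ∧ _))

/-- The missing edges leave a graph whose cliques are points, primitive segments and unimodular
triangles. -/
def LeavesUnimodularCliques (bad : Finset ((ℤ × ℤ) × (ℤ × ℤ))) : Prop :=
  (∀ a ∈ latticeExponents, ∀ b ∈ latticeExponents, a ≠ b → NotMissing bad a b →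
    Int.gcd (b.1 - a.1) (b.2 - a.2) = 1) ∧
  ∀ a ∈ latticeExponents, ∀ b ∈ latticeExponents, a ≠ b → NotMissing bad a b →
    ∀ c ∈ latticeExponents, a ≠ c → b ≠ c → NotMissing bad a c → NotMissing bad b c →
      |latticeDet a b c| = 1 ∧
        ∀ d ∈ latticeExponents, a ≠ d → b ≠ d → c ≠ d →
          ¬ (NotMissing bad a d ∧ NotMissing bad b d ∧ NotMissing bad c d)

set_option synthInstance.maxHeartbeats 400000 in
set_option synthInstance.maxSize 1000 in
instance (bad : Finset ((ℤ × ℤ) × (ℤ × ℤ))) : Decidable (LeavesUnimodularCliques bad) :=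
  inferInstanceAs (Decidable (_ ∧ _))

/-- Exponents in a common cell are pairwise simultaneously minimal, so every cell is a clique in the
graph of allowed pairs. What remains is a finite check on the eight exponents. -/
theorem isTropicallySmooth_of_missing
    (hp : ∀ m, p.coeff m = symCoeff c₁ c₂ c₃ c₄ c₅ (m 0) (m 1)) (hp0 : p ≠ 0)
    {bad : Finset ((ℤ × ℤ) × (ℤ × ℤ))} (h : LeavesUnimodularCliques bad)
    (hbad : ∀ P : ℝ × ℝ, ∀ a b, (a, b) ∈ bad → a ∈ cellVertices v p P →
      b ∈ cellVertices v p P → False) :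
    IsTropicallySmooth v p := by
  intro P hP
  rw [dualCell_eq]
  refine unimodular_of_pairwise_adjacent latticeExponents (NotMissing bad) ?_ ?_
    (fun a ha b hb _ => ⟨fun h => hbad P _ _ h ha hb, fun h => hbad P _ _ h hb ha⟩) h.1 h.2
  · intro z hz
    obtain ⟨i, j, hij, rfl, -⟩ := mem_cellVertices hp hz
    simp only [symExponents, Finset.mem_insert, Finset.mem_singleton, Prod.mk.injEq] at hij
    rcases hij with h | h | h | h | h | h | h | h <;> simp [h.1, h.2, latticeExponents]
  · obtain ⟨m, hm, n, hn, hmn⟩ := nontrivial_of_mem_tropicalCurve hp0 hP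
    refine ⟨_, ⟨m, hm, rfl⟩, _, ⟨n, hn, rfl⟩, fun h => hmn ?_⟩
    simp only [Prod.mk.injEq, Nat.cast_inj] at h
    ext k
    fin_cases k
    · exact h.1
    · exact h.2

theorem val_of_mem_cellVertices (hp : ∀ m, p.coeff m = symCoeff c₁ c₂ c₃ c₄ c₅ (m 0) (m 1))
    {P : ℝ × ℝ} (i j : ℕ) (hz : ((i : ℤ), (j : ℤ)) ∈ cellVertices v p P) :
    symCoeff c₁ c₂ c₃ c₄ c₅ i j ≠ 0 ∧
      realVal v (symCoeff c₁ c₂ c₃ c₄ c₅ i j) + i * P.1 + j * P.2 = trop v p P := by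
  obtain ⟨k, l, -, e, h⟩ := mem_cellVertices hp hz
  simp only [Prod.mk.injEq, Nat.cast_inj] at e
  rwa [e.1, e.2]

/-- Smoothness when the square with vertices `(1,0), (2,0), (2,1), (1,1)` is cut by the diagonal
through `(1,0)` and the square with vertices `(1,1), (2,1), (2,2), (1,2)` by the diagonal
through `(2,1)`. -/
theorem isTropicallySmooth_of_outer_diagonals
    (hp : ∀ m, p.coeff m = symCoeff c₁ c₂ c₃ c₄ c₅ (m 0) (m 1))
    (h₁ : c₁ ≠ 0) (h₃ : c₃ ≠ 0) (h₄ : c₄ ≠ 0)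
    (hc : 2 * realVal v c₃ < realVal v c₁ + realVal v c₄)
    (hc₂ : c₂ ≠ 0 → realVal v c₁ + realVal v c₄ < realVal v c₂ + realVal v c₃)
    (hc₅ : c₅ ≠ 0 → 2 * realVal v c₄ < realVal v c₃ + realVal v c₅) :
    IsTropicallySmooth v p := by
  have hp0 : p ≠ 0 := by
    rintro rfl
    have := hp (expo 1 1)
    simp [symCoeff] at this
    exact h₃ this.symm
  -- Of the `28` pairs of exponents, these `14` are not edges of the intended triangulation; the
  -- other `14` are.
  refine isTropicallySmooth_of_missing hp hp0 (bad := {((2, 0), (1, 1)), ((0, 2), (1, 1)),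
    ((2, 2), (1, 1)), ((2, 0), (2, 2)), ((0, 2), (2, 2)), ((1, 0), (1, 2)), ((0, 1), (2, 1)),
    ((2, 0), (0, 1)), ((0, 2), (1, 0)), ((2, 0), (0, 2)), ((2, 0), (1, 2)), ((0, 2), (2, 1)),
    ((1, 0), (2, 2)), ((0, 1), (2, 2))}) (by decide +kernel) ?_
  -- Each pair is excluded by a convexity relation. For example `(2,0) + (1,1) = (1,0) + (2,1)`, so
  -- if the left pair were minimal at `P`, its total height could not exceed that of the right pair,
  -- against `hc₂`.
  intro P a b hab ha hb
  have l₁₀ := trop_le_symCoeff (v := v) hp (i := 1) (j := 0) h₁ P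
  have l₀₁ := trop_le_symCoeff (v := v) hp (i := 0) (j := 1) h₁ P
  have l₁₁ := trop_le_symCoeff (v := v) hp (i := 1) (j := 1) h₃ P
  have l₂₁ := trop_le_symCoeff (v := v) hp (i := 2) (j := 1) h₄ P
  have l₁₂ := trop_le_symCoeff (v := v) hp (i := 1) (j := 2) h₄ P
  have e₁₀ := val_of_mem_cellVertices (v := v) (P := P) hp 1 0
  have e₀₁ := val_of_mem_cellVertices (v := v) (P := P) hp 0 1
  have e₂₀ := val_of_mem_cellVertices (v := v) (P := P) hp 2 0
  have e₀₂ := val_of_mem_cellVertices (v := v) (P := P) hp 0 2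
  have e₁₁ := val_of_mem_cellVertices (v := v) (P := P) hp 1 1
  have e₂₁ := val_of_mem_cellVertices (v := v) (P := P) hp 2 1
  have e₁₂ := val_of_mem_cellVertices (v := v) (P := P) hp 1 2
  have e₂₂ := val_of_mem_cellVertices (v := v) (P := P) hp 2 2
  simp only [symCoeff, Nat.cast_zero, Nat.cast_one, Nat.cast_ofNat, zero_mul, one_mul, add_zero]
    at l₁₀ l₀₁ l₁₁ l₂₁ l₁₂ e₁₀ e₀₁ e₂₀ e₀₂ e₁₁ e₂₁ e₁₂ e₂₂
  simp only [Finset.mem_insert, Finset.mem_singleton, Prod.mk.injEq] at hab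
  rcases hab with h | h | h | h | h | h | h | h | h | h | h | h | h | h
  all_goals
    obtain ⟨⟨rfl, rfl⟩, rfl, rfl⟩ := h
  · have := hc₂ (e₂₀ ha).1; linarith [(e₂₀ ha).2, (e₁₁ hb).2]
  · have := hc₂ (e₀₂ ha).1; linarith [(e₀₂ ha).2, (e₁₁ hb).2]
  · have := hc₅ (e₂₂ ha).1; linarith [(e₂₂ ha).2, (e₁₁ hb).2]
  · have := hc₂ (e₂₀ ha).1; have := hc₅ (e₂₂ hb).1; linarith [(e₂₀ ha).2, (e₂₂ hb).2]
  · have := hc₂ (e₀₂ ha).1; have := hc₅ (e₂₂ hb).1; linarith [(e₀₂ ha).2, (e₂₂ hb).2]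
  · linarith [(e₁₀ ha).2, (e₁₂ hb).2]
  · linarith [(e₀₁ ha).2, (e₂₁ hb).2]
  · have := hc₂ (e₂₀ ha).1; linarith [(e₂₀ ha).2, (e₀₁ hb).2]
  · have := hc₂ (e₀₂ ha).1; linarith [(e₀₂ ha).2, (e₁₀ hb).2]
  · have := hc₂ (e₂₀ ha).1; linarith [(e₂₀ ha).2, (e₀₂ hb).2]
  · have := hc₂ (e₂₀ ha).1; linarith [(e₂₀ ha).2, (e₁₂ hb).2]
  · have := hc₂ (e₀₂ ha).1; linarith [(e₀₂ ha).2, (e₂₁ hb).2]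
  · have := hc₅ (e₂₂ hb).1; linarith [(e₁₀ ha).2, (e₂₂ hb).2]
  · have := hc₅ (e₂₂ hb).1; linarith [(e₀₁ ha).2, (e₂₂ hb).2]

/-- Smoothness when the dual subdivision is the star triangulation with centre `(1,1)`. -/
theorem isTropicallySmooth_of_star
    (hp : ∀ m, p.coeff m = symCoeff c₁ c₂ c₃ c₄ c₅ (m 0) (m 1))
    (h₁ : c₁ ≠ 0) (h₂ : c₂ ≠ 0) (h₃ : c₃ ≠ 0) (h₄ : c₄ ≠ 0) (h₅ : c₅ ≠ 0)
    (hc₁ : realVal v c₂ + realVal v c₃ < realVal v c₁ + realVal v c₄)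
    (hc₂ : realVal v c₃ + realVal v c₅ < 2 * realVal v c₄)
    (hc₃ : 2 * realVal v c₄ < realVal v c₂ + realVal v c₅) :
    IsTropicallySmooth v p := by
  have hp0 : p ≠ 0 := by
    rintro rfl
    have := hp (expo 1 1)
    simp [symCoeff] at this
    exact h₃ this.symm
  refine isTropicallySmooth_of_missing hp hp0 (bad := {((1, 0), (2, 1)), ((0, 1), (1, 2)),
    ((1, 0), (2, 2)), ((0, 1), (2, 2)), ((1, 0), (1, 2)), ((0, 1), (2, 1)), ((1, 0), (0, 2)),
    ((0, 1), (2, 0)), ((2, 0), (2, 2)), ((0, 2), (2, 2)), ((2, 0), (1, 2)), ((0, 2), (2, 1)),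
    ((2, 0), (0, 2)), ((2, 1), (1, 2))}) (by decide +kernel) ?_
  intro P a b hab ha hb
  have l₁₀ := trop_le_symCoeff (v := v) hp (i := 1) (j := 0) h₁ P
  have l₀₁ := trop_le_symCoeff (v := v) hp (i := 0) (j := 1) h₁ P
  have l₂₀ := trop_le_symCoeff (v := v) hp (i := 2) (j := 0) h₂ P
  have l₀₂ := trop_le_symCoeff (v := v) hp (i := 0) (j := 2) h₂ P
  have l₁₁ := trop_le_symCoeff (v := v) hp (i := 1) (j := 1) h₃ P
  have l₂₁ := trop_le_symCoeff (v := v) hp (i := 2) (j := 1) h₄ P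
  have l₁₂ := trop_le_symCoeff (v := v) hp (i := 1) (j := 2) h₄ P
  have l₂₂ := trop_le_symCoeff (v := v) hp (i := 2) (j := 2) h₅ P
  have e₁₀ := fun h => (val_of_mem_cellVertices (v := v) (P := P) hp 1 0 h).2
  have e₀₁ := fun h => (val_of_mem_cellVertices (v := v) (P := P) hp 0 1 h).2
  have e₂₀ := fun h => (val_of_mem_cellVertices (v := v) (P := P) hp 2 0 h).2
  have e₀₂ := fun h => (val_of_mem_cellVertices (v := v) (P := P) hp 0 2 h).2
  have e₂₁ := fun h => (val_of_mem_cellVertices (v := v) (P := P) hp 2 1 h).2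
  have e₁₂ := fun h => (val_of_mem_cellVertices (v := v) (P := P) hp 1 2 h).2
  have e₂₂ := fun h => (val_of_mem_cellVertices (v := v) (P := P) hp 2 2 h).2
  simp only [symCoeff, Nat.cast_zero, Nat.cast_one, Nat.cast_ofNat, zero_mul, one_mul, add_zero]
    at l₁₀ l₀₁ l₂₀ l₀₂ l₁₁ l₂₁ l₁₂ l₂₂ e₁₀ e₀₁ e₂₀ e₀₂ e₂₁ e₁₂ e₂₂
  simp only [Finset.mem_insert, Finset.mem_singleton, Prod.mk.injEq] at hab
  rcases hab with h | h | h | h | h | h | h | h | h | h | h | h | h | h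
  all_goals
    obtain ⟨⟨rfl, rfl⟩, rfl, rfl⟩ := h
  · linarith [e₁₀ ha, e₂₁ hb]
  · linarith [e₀₁ ha, e₁₂ hb]
  · linarith [e₁₀ ha, e₂₂ hb]
  · linarith [e₀₁ ha, e₂₂ hb]
  · linarith [e₁₀ ha, e₁₂ hb]
  · linarith [e₀₁ ha, e₂₁ hb]
  · linarith [e₁₀ ha, e₀₂ hb]
  · linarith [e₀₁ ha, e₂₀ hb]
  · linarith [e₂₀ ha, e₂₂ hb]
  · linarith [e₀₂ ha, e₂₂ hb]
  · linarith [e₂₀ ha, e₁₂ hb]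
  · linarith [e₀₂ ha, e₂₁ hb]
  · linarith [e₂₀ ha, e₀₂ hb]
  · linarith [e₂₁ ha, e₁₂ hb]

/-- The forms of `p` are bounded below as soon as the forms of its eight possible monomials are. -/
theorem le_monomialForm (hp : ∀ m, p.coeff m = symCoeff c₁ c₂ c₃ c₄ c₅ (m 0) (m 1)) {T : ℝ}
    {P : ℝ × ℝ} (h₁₀ : c₁ ≠ 0 → T ≤ realVal v c₁ + P.1) (h₀₁ : c₁ ≠ 0 → T ≤ realVal v c₁ + P.2)
    (h₂₀ : c₂ ≠ 0 → T ≤ realVal v c₂ + 2 * P.1) (h₀₂ : c₂ ≠ 0 → T ≤ realVal v c₂ + 2 * P.2)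
    (h₁₁ : c₃ ≠ 0 → T ≤ realVal v c₃ + P.1 + P.2)
    (h₂₁ : c₄ ≠ 0 → T ≤ realVal v c₄ + 2 * P.1 + P.2)
    (h₁₂ : c₄ ≠ 0 → T ≤ realVal v c₄ + P.1 + 2 * P.2)
    (h₂₂ : c₅ ≠ 0 → T ≤ realVal v c₅ + 2 * P.1 + 2 * P.2) :
    ∀ m ∈ p.support, T ≤ monomialForm v p m P := by
  intro m hm
  have h0 := MvPolynomial.mem_support_iff.1 hm
  have hmem := exists_mem_symExponents hp hm
  rw [hp] at h0
  rw [monomialForm, hp]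
  change T ≤ realVal v _ + _ + _
  simp only [symExponents, Finset.mem_insert, Finset.mem_singleton, Prod.mk.injEq] at hmem
  rcases hmem with h | h | h | h | h | h | h | h <;> rw [h.1, h.2] at h0 ⊢ <;>
    simp only [symCoeff, Nat.cast_zero, Nat.cast_one, Nat.cast_ofNat, zero_mul, one_mul,
      add_zero] at h0 ⊢ <;> simp only [*, ne_eq, not_false_eq_true]

theorem mem_minimalExponents_expo (hp : ∀ m, p.coeff m = symCoeff c₁ c₂ c₃ c₄ c₅ (m 0) (m 1))
    {T : ℝ} {P : ℝ × ℝ} (hT : ∀ m ∈ p.support, T ≤ monomialForm v p m P) (i j : ℕ)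
    (h : symCoeff c₁ c₂ c₃ c₄ c₅ i j ≠ 0)
    (hT' : realVal v (symCoeff c₁ c₂ c₃ c₄ c₅ i j) + i * P.1 + j * P.2 = T) :
    expo i j ∈ minimalExponents v p P := by
  have hc : p.coeff (expo i j) = symCoeff c₁ c₂ c₃ c₄ c₅ i j := by rw [hp]; simp
  refine mem_minimalExponents_iff.2 ⟨MvPolynomial.mem_support_iff.2 (hc ▸ h), fun n hn => ?_⟩
  refine le_trans (le_of_eq ?_) (hT n hn)
  rw [← hT', monomialForm, hc, expo_zero, expo_one, realVal]

theorem latticePt_mem_dualCell {P : ℝ × ℝ} {i j : ℕ} (h : expo i j ∈ minimalExponents v p P) :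
    latticePt (i, j) ∈ dualCell v p P :=
  subset_convexHull ℝ _ ⟨_, h, by simp [latticePt]⟩

theorem not_isTropicallySmooth_of_four {P : ℝ × ℝ} (hP : (minimalExponents v p P).Nontrivial)
    {T : Finset (ℤ × ℤ)} (hT : 3 < T.card) (hS : ∀ z ∈ T, latticePt z ∈ dualCell v p P) :
    ¬ IsTropicallySmooth v p := fun h =>
  not_unimodular_of_four_lattice_points hT hS (h P (mem_tropicalCurve_of_nontrivial hP))

theorem expo_ne {i j k l : ℕ} (h : (i, j) ≠ (k, l)) : expo i j ≠ expo k l := fun e =>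
  h (by rw [expo_eq_iff, expo_zero, expo_one] at e; rw [e.1, e.2])

/-- Non-smoothness when `(2,0), (2,2), (1,1)` lie in one cell. -/
theorem not_isTropicallySmooth_of_long_edge
    (hp : ∀ m, p.coeff m = symCoeff c₁ c₂ c₃ c₄ c₅ (m 0) (m 1))
    (h₂ : c₂ ≠ 0) (h₃ : c₃ ≠ 0) (h₅ : c₅ ≠ 0)
    (hc₁ : c₁ ≠ 0 → 2 * realVal v c₃ + realVal v c₂ ≤ 2 * realVal v c₁ + realVal v c₅ ∧
      4 * realVal v c₃ ≤ 2 * realVal v c₁ + realVal v c₂ + realVal v c₅)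
    (hc₃ : realVal v c₃ ≤ realVal v c₂)
    (hc₄ : c₄ ≠ 0 → realVal v c₂ + realVal v c₅ ≤ 2 * realVal v c₄ ∧
      2 * realVal v c₃ + realVal v c₅ ≤ 2 * realVal v c₄ + realVal v c₂) :
    ¬ IsTropicallySmooth v p := by
  -- The point at which the forms of `(2,0)`, `(2,2)` and `(1,1)` agree.
  set Y := (realVal v c₂ - realVal v c₅) / 2 with hY
  set X := realVal v c₃ - realVal v c₂ + Y with hX
  have hT := le_monomialForm (v := v) hp (T := realVal v c₂ + 2 * X) (P := (X, Y))
    (fun h => by have := hc₁ h; simp only; linarith) (fun h => by have := hc₁ h; simp only; linarith)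
    (fun h => le_rfl) (fun h => by simp only; linarith) (fun h => by simp only; linarith)
    (fun h => by have := hc₄ h; simp only; linarith) (fun h => by have := hc₄ h; simp only; linarith)
    (fun h => by simp only; linarith)
  have m₂₀ := mem_minimalExponents_expo hp hT 2 0 h₂ (by simp [symCoeff])
  have m₁₁ := mem_minimalExponents_expo hp hT 1 1 h₃ (by simp [symCoeff]; linarith)
  have m₂₂ := mem_minimalExponents_expo hp hT 2 2 h₅ (by simp [symCoeff]; linarith)
  refine not_isTropicallySmooth_of_four ⟨_, m₂₀, _, m₁₁, expo_ne (by decide)⟩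
    (T := {(2, 0), (1, 1), (2, 2), (2, 1)}) (by decide) ?_
  simp only [Finset.mem_insert, Finset.mem_singleton, forall_eq_or_imp, forall_eq]
  refine ⟨latticePt_mem_dualCell m₂₀, latticePt_mem_dualCell m₁₁, latticePt_mem_dualCell m₂₂, ?_⟩
  -- The fourth lattice point `(2,1)` lies in the cell as a midpoint, whether or not its monomial
  -- occurs in `p`.
  have := (convex_convexHull ℝ _).midpoint_mem (latticePt_mem_dualCell m₂₀)
    (latticePt_mem_dualCell m₂₂)
  convert! this using 1
  simp [latticePt, midpoint_eq_smul_add]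
  norm_num

/-- Non-smoothness when the square with vertices `(1,0), (2,0), (2,1), (1,1)` is not cut. -/
theorem not_isTropicallySmooth_of_square
    (hp : ∀ m, p.coeff m = symCoeff c₁ c₂ c₃ c₄ c₅ (m 0) (m 1))
    (h₁ : c₁ ≠ 0) (h₂ : c₂ ≠ 0) (h₃ : c₃ ≠ 0) (h₄ : c₄ ≠ 0)
    (hc : realVal v c₁ + realVal v c₄ = realVal v c₂ + realVal v c₃)
    (hc₃ : 2 * realVal v c₃ ≤ realVal v c₁ + realVal v c₄)
    (hc₅ : c₅ ≠ 0 → realVal v c₃ + realVal v c₄ ≤ realVal v c₁ + realVal v c₅) :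
    ¬ IsTropicallySmooth v p := by
  -- `X` equates the forms of `(1,1)` and `(2,1)`, and `Y` those of `(1,0)` and `(1,1)`; by `hc` the
  -- form of `(2,0)` then agrees as well.
  set X := realVal v c₃ - realVal v c₄ with hX
  set Y := realVal v c₁ - realVal v c₃ with hY
  have hT := le_monomialForm (v := v) hp (T := realVal v c₁ + X) (P := (X, Y))
    (fun h => le_rfl) (fun h => by simp only; linarith)
    (fun h => by simp only; linarith) (fun h => by simp only; linarith)
    (fun h => by simp only; linarith)
    (fun h => by simp only; linarith) (fun h => by simp only; linarith)
    (fun h => by have := hc₅ h; simp only; linarith)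
  have m₁₀ := mem_minimalExponents_expo hp hT 1 0 h₁ (by simp [symCoeff])
  have m₂₀ := mem_minimalExponents_expo hp hT 2 0 h₂ (by simp [symCoeff]; linarith)
  have m₁₁ := mem_minimalExponents_expo hp hT 1 1 h₃ (by simp [symCoeff]; linarith)
  have m₂₁ := mem_minimalExponents_expo hp hT 2 1 h₄ (by simp [symCoeff]; linarith)
  refine not_isTropicallySmooth_of_four ⟨_, m₂₀, _, m₁₁, expo_ne (by decide)⟩
    (T := {(1, 0), (2, 0), (1, 1), (2, 1)}) (by decide) ?_
  simp only [Finset.mem_insert, Finset.mem_singleton, forall_eq_or_imp, forall_eq]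
  exact ⟨latticePt_mem_dualCell m₁₀, latticePt_mem_dualCell m₂₀, latticePt_mem_dualCell m₁₁,
    latticePt_mem_dualCell m₂₁⟩

/-- Non-smoothness when the trapezoid with vertices `(1,0), (2,0), (0,2), (0,1)` lies in one
cell. -/
theorem not_isTropicallySmooth_of_trapezoid
    (hp : ∀ m, p.coeff m = symCoeff c₁ c₂ c₃ c₄ c₅ (m 0) (m 1))
    (h₁ : c₁ ≠ 0) (h₂ : c₂ ≠ 0)
    (hc₃ : c₃ ≠ 0 → realVal v c₂ ≤ realVal v c₃)
    (hc₄ : c₄ ≠ 0 → 2 * realVal v c₂ ≤ realVal v c₁ + realVal v c₄)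
    (hc₅ : c₅ ≠ 0 → 3 * realVal v c₂ ≤ 2 * realVal v c₁ + realVal v c₅) :
    ¬ IsTropicallySmooth v p := by
  -- By symmetry the four forms agree at a diagonal point, fixed by `c₁ + X = c₂ + 2X` on
  -- valuations.
  set X := realVal v c₁ - realVal v c₂ with hX
  have hT := le_monomialForm (v := v) hp (T := realVal v c₁ + X) (P := (X, X))
    (fun h => le_rfl) (fun h => le_rfl)
    (fun h => by simp only; linarith) (fun h => by simp only; linarith)
    (fun h => by have := hc₃ h; simp only; linarith)
    (fun h => by have := hc₄ h; simp only; linarith)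
    (fun h => by have := hc₄ h; simp only; linarith)
    (fun h => by have := hc₅ h; simp only; linarith)
  have m₁₀ := mem_minimalExponents_expo hp hT 1 0 h₁ (by simp [symCoeff])
  have m₀₁ := mem_minimalExponents_expo hp hT 0 1 h₁ (by simp [symCoeff])
  have m₂₀ := mem_minimalExponents_expo hp hT 2 0 h₂ (by simp [symCoeff]; linarith)
  have m₀₂ := mem_minimalExponents_expo hp hT 0 2 h₂ (by simp [symCoeff]; linarith)
  refine not_isTropicallySmooth_of_four ⟨_, m₁₀, _, m₀₁, expo_ne (by decide)⟩
    (T := {(1, 0), (0, 1), (2, 0), (0, 2)}) (by decide) ?_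
  simp only [Finset.mem_insert, Finset.mem_singleton, forall_eq_or_imp, forall_eq]
  exact ⟨latticePt_mem_dualCell m₁₀, latticePt_mem_dualCell m₀₁, latticePt_mem_dualCell m₂₀,
    latticePt_mem_dualCell m₀₂⟩

end SymmetricBiquadratic

/-! ### Valuations of the coefficients and the cases of `δ` -/

section Valuations

variable {F : Type*} [Field F] {v : AddValuation F (WithTop ℚ)}

theorem exists_val_eq {x : F} (hx : x ≠ 0) : ∃ a : ℚ, v x = (a : WithTop ℚ) :=
  (WithTop.ne_top_iff_exists.1 ((AddValuation.ne_top_iff v).2 hx)).imp fun _ h => h.symm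

theorem ne_zero_of_val_eq {x : F} {a : ℚ} (h : v x = (a : WithTop ℚ)) : x ≠ 0 :=
  (AddValuation.ne_top_iff v).1 (h ▸ WithTop.coe_ne_top)

theorem realVal_of_eq {x : F} {a : ℚ} (h : v x = (a : WithTop ℚ)) : realVal v x = a := by
  rw [realVal, h, WithTop.untopD_coe]

theorem le_realVal {x : F} {a : ℚ} (hx : x ≠ 0) (h : (a : WithTop ℚ) ≤ v x) :
    (a : ℝ) ≤ realVal v x := by
  obtain ⟨b, hb⟩ := exists_val_eq (v := v) hx
  rw [realVal_of_eq hb]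
  rw [hb, WithTop.coe_le_coe] at h
  exact_mod_cast h

theorem val_mul_eq {x y : F} {a b : ℚ} (hx : v x = (a : WithTop ℚ)) (hy : v y = (b : WithTop ℚ)) :
    v (x * y) = ((a + b : ℚ) : WithTop ℚ) := by
  rw [AddValuation.map_mul, hx, hy, WithTop.coe_add]

theorem le_val_mul {x y : F} {a b : ℚ} (hx : (a : WithTop ℚ) ≤ v x) (hy : (b : WithTop ℚ) ≤ v y) :
    ((a + b : ℚ) : WithTop ℚ) ≤ v (x * y) := by
  rw [AddValuation.map_mul, WithTop.coe_add]
  exact add_le_add hx hy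

theorem val_add_eq {x y : F} {a b : ℚ} (hx : v x = (a : WithTop ℚ)) (hy : (b : WithTop ℚ) ≤ v y)
    (hab : a < b) : v (x + y) = (a : WithTop ℚ) := by
  rw [AddValuation.map_add_eq_of_lt_left, hx]
  exact hx ▸ (WithTop.coe_lt_coe.2 hab).trans_le hy

theorem val_sub_eq {x y : F} {a b : ℚ} (hx : v x = (a : WithTop ℚ)) (hy : (b : WithTop ℚ) ≤ v y)
    (hab : a < b) : v (x - y) = (a : WithTop ℚ) := by
  rw [sub_eq_add_neg]
  exact val_add_eq hx (by rwa [AddValuation.map_neg]) hab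

theorem le_val_of_le {x : F} {a b : ℚ} (hx : (b : WithTop ℚ) ≤ v x) (hab : a ≤ b) :
    (a : WithTop ℚ) ≤ v x := (WithTop.coe_le_coe.2 hab).trans hx

theorem zero_le_val_two : ((0 : ℚ) : WithTop ℚ) ≤ v 2 := by
  have h1 : ((0 : ℚ) : WithTop ℚ) ≤ v 1 := (AddValuation.map_one v).ge
  rw [← one_add_one_eq_two]
  exact AddValuation.map_le_add v h1 h1

theorem zero_le_val_three : ((0 : ℚ) : WithTop ℚ) ≤ v 3 := by
  rw [← two_add_one_eq_three]
  exact AddValuation.map_le_add v zero_le_val_two (AddValuation.map_one v).ge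

/-- `A` and `B` agree with `1` and `Q` to first order. -/
structure IsFirstOrder (v : AddValuation F (WithTop ℚ)) (A B Q : F) : Prop where
  val_sub_one : ((1 : ℚ) : WithTop ℚ) ≤ v (A - 1)
  val_sub : ((2 : ℚ) : WithTop ℚ) ≤ v (B - Q)
  val_param : v Q = ((1 : ℚ) : WithTop ℚ)

namespace IsFirstOrder

variable {A B Q r s : F} {m p w t : ℚ}

theorem val_fst (h : IsFirstOrder v A B Q) : v A = ((0 : ℚ) : WithTop ℚ) := by
  rw [← add_sub_cancel 1 A]
  exact val_add_eq (AddValuation.map_one v) h.val_sub_one one_pos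

theorem val_snd (h : IsFirstOrder v A B Q) : v B = ((1 : ℚ) : WithTop ℚ) := by
  rw [← add_sub_cancel Q B]
  exact val_add_eq h.val_param h.val_sub one_lt_two

theorem val_sq_add (h : IsFirstOrder v A B Q) : v (A ^ 2 + B ^ 2) = ((0 : ℚ) : WithTop ℚ) := by
  rw [pow_two, pow_two]
  simpa using val_add_eq (val_mul_eq h.val_fst h.val_fst) (val_mul_eq h.val_snd h.val_snd).ge
    (by norm_num)

theorem val_sq_sub (h : IsFirstOrder v A B Q) : v (A ^ 2 - B ^ 2) = ((0 : ℚ) : WithTop ℚ) := by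
  rw [pow_two, pow_two]
  simpa using val_sub_eq (val_mul_eq h.val_fst h.val_fst) (val_mul_eq h.val_snd h.val_snd).ge
    (by norm_num)

theorem val_cube_even (h : IsFirstOrder v A B Q) :
    v (A ^ 3 + 3 * A * B ^ 2) = ((0 : ℚ) : WithTop ℚ) := by
  have h3 := zero_le_val_three (v := v)
  have e : A ^ 3 + 3 * A * B ^ 2 = A * (A * A + 3 * (B * B)) := by ring
  rw [e]
  simpa using val_mul_eq h.val_fst (val_add_eq (val_mul_eq h.val_fst h.val_fst)
    (le_val_mul h3 (val_mul_eq h.val_snd h.val_snd).ge) (by norm_num))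

theorem le_val_cube_odd (h : IsFirstOrder v A B Q) :
    ((1 : ℚ) : WithTop ℚ) ≤ v (3 * A ^ 2 * B + B ^ 3) := by
  have h3 := zero_le_val_three (v := v)
  have e : 3 * A ^ 2 * B + B ^ 3 = B * (3 * (A * A) + B * B) := by ring
  rw [e]
  simpa using le_val_mul h.val_snd.ge (AddValuation.map_le_add v (g := ((0 : ℚ) : WithTop ℚ))
    (le_val_of_le (le_val_mul h3 (val_mul_eq h.val_fst h.val_fst).ge) (by norm_num))
    (le_val_of_le (val_mul_eq h.val_snd h.val_snd).ge (by norm_num)))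

/-! Valuations of the factors of the coefficients, for `M = r - s` and `P = r + s`. -/

theorem val_factor_of_gt (h : IsFirstOrder v A B Q)
    {M P : F} (hM : v M = (m : WithTop ℚ)) (hP : (p : WithTop ℚ) ≤ v P)
    (hmp : m < p + 1) : v (A * M - B * P) = (m : WithTop ℚ) := by
  simpa using val_sub_eq (val_mul_eq h.val_fst hM) (le_val_mul h.val_snd.ge hP) (by linarith)

theorem val_factor_add_of_gt (h : IsFirstOrder v A B Q)
    {M P : F} (hM : v M = (m : WithTop ℚ)) (hP : (p : WithTop ℚ) ≤ v P)
    (hmp : m < p + 1) : v (A * M + B * P) = (m : WithTop ℚ) := by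
  simpa using val_add_eq (val_mul_eq h.val_fst hM) (le_val_mul h.val_snd.ge hP) (by linarith)

theorem val_factor_of_lt (h : IsFirstOrder v A B Q)
    {M P : F} (hM : (m : WithTop ℚ) ≤ v M) (hP : v P = (p : WithTop ℚ))
    (hmp : m + 1 > p) : v (A * P + B * M) = (p : WithTop ℚ) ∧ v (A * P - B * M) = (p : WithTop ℚ) :=
  ⟨h.val_factor_add_of_gt hP hM hmp, h.val_factor_of_gt hP hM hmp⟩

theorem val_factor_of_far (h : IsFirstOrder v A B Q)
    {M P : F} (hM : v M = (m : WithTop ℚ)) (hP : (p : WithTop ℚ) ≤ v P)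
    (hmp : m + 1 < p) : v (A * P + B * M) = ((m + 1 : ℚ) : WithTop ℚ) ∧
      v (A * P - B * M) = ((m + 1 : ℚ) : WithTop ℚ) := by
  have h₁ := val_mul_eq h.val_snd hM
  have h₂ := le_val_mul h.val_fst.ge hP
  rw [add_comm 1 m] at h₁
  constructor
  · rw [add_comm]
    exact val_add_eq h₁ h₂ (by linarith)
  · rw [AddValuation.map_sub_swap]
    exact val_sub_eq h₁ h₂ (by linarith)

theorem val_cubic_factor (h : IsFirstOrder v A B Q)
    {M P : F} (hM : v M = (m : WithTop ℚ)) (hP : (p : WithTop ℚ) ≤ v P)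
    (hmp : m < p + 1) : v ((A ^ 3 + 3 * A * B ^ 2) * M - (3 * A ^ 2 * B + B ^ 3) * P) =
      (m : WithTop ℚ) := by
  simpa using val_sub_eq (val_mul_eq h.val_cube_even hM) (le_val_mul h.le_val_cube_odd hP)
    (by linarith)

/-- The terms in `P²` and `M²` have valuations at least `1 + 2p` and `3 + 2m`. Both exceed `m + p`,
the valuation of the main term in `MP`, exactly when `-1 < p - m < 3`. -/
theorem le_val_quadratic_remainder (h : IsFirstOrder v A B Q)
    {M P : F} (hM : (m : WithTop ℚ) ≤ v M)
    (hP : (p : WithTop ℚ) ≤ v P) {g : ℚ} (h₁ : g ≤ 1 + 2 * p) (h₂ : g ≤ 3 + 2 * m) :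
    (g : WithTop ℚ) ≤ v (2 * (A * (B * (B * B * (M * M) - A * A * (P * P))))) := by
  have h2 := zero_le_val_two (v := v)
  have key : ((g - 1 : ℚ) : WithTop ℚ) ≤ v (B * B * (M * M) - A * A * (P * P)) :=
    AddValuation.map_le_sub v
      (le_val_of_le (le_val_mul (val_mul_eq h.val_snd h.val_snd).ge (le_val_mul hM hM))
        (by linarith))
      (le_val_of_le (le_val_mul (val_mul_eq h.val_fst h.val_fst).ge (le_val_mul hP hP))
        (by linarith))
  exact le_val_of_le (le_val_mul h2 (le_val_mul h.val_fst.ge (le_val_mul h.val_snd.ge key)))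
    (by linarith)

/-- The quadratic factor of `d₆₇`. -/
theorem val_quadratic_factor (h : IsFirstOrder v A B Q)
    {M P : F} (hM : v M = (m : WithTop ℚ)) (hP : v P = (p : WithTop ℚ))
    (h₁ : m < p + 1) (h₂ : p < m + 3) :
    v ((A ^ 2 - B ^ 2) * (A ^ 2 + B ^ 2) * (M * P) +
      2 * (A * (B * (B * B * (M * M) - A * A * (P * P))))) = ((m + p : ℚ) : WithTop ℚ) := by
  simpa using val_add_eq (val_mul_eq (val_mul_eq h.val_sq_sub h.val_sq_add) (val_mul_eq hM hP))
    (h.le_val_quadratic_remainder hM.ge hP.ge (min_le_left _ _) (min_le_right _ _))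
    (lt_min (by linarith) (by linarith))

theorem le_val_quadratic_factor (h : IsFirstOrder v A B Q)
    {M P : F} (hM : (m : WithTop ℚ) ≤ v M)
    (hP : (p : WithTop ℚ) ≤ v P) {g : ℚ} (h₁ : g ≤ 1 + 2 * p) (h₂ : g ≤ 3 + 2 * m)
    (h₃ : g ≤ m + p) :
    (g : WithTop ℚ) ≤ v ((A ^ 2 - B ^ 2) * (A ^ 2 + B ^ 2) * (M * P) +
      2 * (A * (B * (B * B * (M * M) - A * A * (P * P))))) :=
  AddValuation.map_le_add v
    (le_val_of_le (le_val_mul (val_mul_eq h.val_sq_sub h.val_sq_add).ge (le_val_mul hM hP))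
      (by linarith))
    (h.le_val_quadratic_remainder hM hP h₁ h₂)

end IsFirstOrder

section Factorizations

variable (A B r s : F)

/-! Factorizations of the coefficients, for `ε = A + B` and `ε̄ = A - B`. -/

theorem d12_eq : d12 (A + B) (A - B) r s = -(2 * (A * (r - s) + B * (r + s)) *
    (2 * (2 * (2 * ((A ^ 2 - B ^ 2) * (A * (B * (A ^ 2 + B ^ 2)))))))) := by
  unfold d12; ring

theorem d34_eq : d34 (A + B) (A - B) r s = -(2 * (A * (r - s) + B * (r + s)) *
    (2 * (2 * (A * (B * ((A ^ 2 + B ^ 2) * (A * (r + s) + B * (r - s)))))))) := by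
  unfold d34; ring

theorem d5_eq : d5 (A + B) (A - B) r s = 2 * (A * (r - s) + B * (r + s)) *
    (2 * (2 * ((A ^ 2 - B ^ 2) *
      ((A ^ 3 + 3 * A * B ^ 2) * (r - s) - (3 * A ^ 2 * B + B ^ 3) * (r + s))))) := by
  unfold d5; ring

theorem d67_eq : d67 (A + B) (A - B) r s = 2 * (A * (r - s) + B * (r + s)) *
    (2 * ((A ^ 2 - B ^ 2) * (A ^ 2 + B ^ 2) * ((r - s) * (r + s)) +
      2 * (A * (B * (B * B * ((r - s) * (r - s)) - A * A * ((r + s) * (r + s))))))) := by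
  unfold d67; ring

theorem d8_eq : d8 (A + B) (A - B) r s = 2 * (A * (r - s) + B * (r + s)) *
    ((A * (r - s) - B * (r + s)) *
      ((A * (r + s) - B * (r - s)) * (A * (r + s) + B * (r - s)))) := by
  unfold d8; ring

end Factorizations

namespace IsFirstOrder

variable {A B Q r s : F} {m p w t x y z : ℚ}

/-- Across the five coefficients the multiples of `t = v(2)` are `3, 2, 2, 1, 0`, that is `4 - i -
j` at the monomial `xⁱ yʲ`. This is affine in the exponent, so `t` cancels from every convexity
inequality, as does the common `w`. -/
theorem val_d12 (h : IsFirstOrder v A B Q)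
    (hw : v (2 * (A * (r - s) + B * (r + s))) = (w : WithTop ℚ)) (ht : v 2 = (t : WithTop ℚ)) :
    v (d12 (A + B) (A - B) r s) = ((w + 3 * t + 1 : ℚ) : WithTop ℚ) := by
  rw [d12_eq, AddValuation.map_neg, val_mul_eq hw (val_mul_eq ht (val_mul_eq ht (val_mul_eq ht
    (val_mul_eq h.val_sq_sub (val_mul_eq h.val_fst (val_mul_eq h.val_snd h.val_sq_add))))))]
  congr 1; ring

theorem val_d34 (h : IsFirstOrder v A B Q)
    (hw : v (2 * (A * (r - s) + B * (r + s))) = (w : WithTop ℚ)) (ht : v 2 = (t : WithTop ℚ))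
    (hx : v (A * (r + s) + B * (r - s)) = (x : WithTop ℚ)) :
    v (d34 (A + B) (A - B) r s) = ((w + 2 * t + 1 + x : ℚ) : WithTop ℚ) := by
  rw [d34_eq, AddValuation.map_neg, val_mul_eq hw (val_mul_eq ht (val_mul_eq ht
    (val_mul_eq h.val_fst (val_mul_eq h.val_snd (val_mul_eq h.val_sq_add hx)))))]
  congr 1; ring

theorem val_d5 (h : IsFirstOrder v A B Q)
    (hw : v (2 * (A * (r - s) + B * (r + s))) = (w : WithTop ℚ)) (ht : v 2 = (t : WithTop ℚ))
    (hM : v (r - s) = (m : WithTop ℚ)) (hP : (p : WithTop ℚ) ≤ v (r + s)) (hmp : m < p + 1) :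
    v (d5 (A + B) (A - B) r s) = ((w + 2 * t + m : ℚ) : WithTop ℚ) := by
  rw [d5_eq, val_mul_eq hw (val_mul_eq ht (val_mul_eq ht
    (val_mul_eq h.val_sq_sub (h.val_cubic_factor hM hP hmp))))]
  congr 1; ring

theorem le_val_d5 (h : IsFirstOrder v A B Q)
    (hw : v (2 * (A * (r - s) + B * (r + s))) = (w : WithTop ℚ)) (ht : v 2 = (t : WithTop ℚ))
    (hM : ((p + 1 : ℚ) : WithTop ℚ) ≤ v (r - s)) (hP : (p : WithTop ℚ) ≤ v (r + s)) :
    ((w + 2 * t + p + 1 : ℚ) : WithTop ℚ) ≤ v (d5 (A + B) (A - B) r s) := by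
  rw [d5_eq]
  have key : ((p + 1 : ℚ) : WithTop ℚ) ≤
      v ((A ^ 3 + 3 * A * B ^ 2) * (r - s) - (3 * A ^ 2 * B + B ^ 3) * (r + s)) :=
    AddValuation.map_le_sub v (le_val_of_le (le_val_mul h.val_cube_even.ge hM) (by linarith))
      (le_val_of_le (le_val_mul h.le_val_cube_odd hP) (by linarith))
  exact le_val_of_le (le_val_mul hw.ge (le_val_mul ht.ge (le_val_mul ht.ge
    (le_val_mul h.val_sq_sub.ge key)))) (by linarith)

theorem val_d67 (h : IsFirstOrder v A B Q)
    (hw : v (2 * (A * (r - s) + B * (r + s))) = (w : WithTop ℚ)) (ht : v 2 = (t : WithTop ℚ))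
    (hM : v (r - s) = (m : WithTop ℚ)) (hP : v (r + s) = (p : WithTop ℚ))
    (h₁ : m < p + 1) (h₂ : p < m + 3) :
    v (d67 (A + B) (A - B) r s) = ((w + t + m + p : ℚ) : WithTop ℚ) := by
  rw [d67_eq, val_mul_eq hw (val_mul_eq ht (h.val_quadratic_factor hM hP h₁ h₂))]
  congr 1; ring

theorem le_val_d67 (h : IsFirstOrder v A B Q)
    (hw : v (2 * (A * (r - s) + B * (r + s))) = (w : WithTop ℚ)) (ht : v 2 = (t : WithTop ℚ))
    (hM : (m : WithTop ℚ) ≤ v (r - s)) (hP : (p : WithTop ℚ) ≤ v (r + s))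
    (h₁ : x ≤ 1 + 2 * p) (h₂ : x ≤ 3 + 2 * m) (h₃ : x ≤ m + p) :
    ((w + t + x : ℚ) : WithTop ℚ) ≤ v (d67 (A + B) (A - B) r s) := by
  rw [d67_eq]
  exact le_val_of_le (le_val_mul hw.ge (le_val_mul ht.ge
    (h.le_val_quadratic_factor hM hP h₁ h₂ h₃))) (by linarith)

theorem val_d8 (hw : v (2 * (A * (r - s) + B * (r + s))) = (w : WithTop ℚ))
    (hx : v (A * (r - s) - B * (r + s)) = (x : WithTop ℚ))
    (hy : v (A * (r + s) - B * (r - s)) = (y : WithTop ℚ))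
    (hz : v (A * (r + s) + B * (r - s)) = (z : WithTop ℚ)) :
    v (d8 (A + B) (A - B) r s) = ((w + x + y + z : ℚ) : WithTop ℚ) := by
  rw [d8_eq, val_mul_eq hw (val_mul_eq hx (val_mul_eq hy hz))]
  congr 1; ring

theorem le_val_d8 (hw : v (2 * (A * (r - s) + B * (r + s))) = (w : WithTop ℚ))
    (hx : (x : WithTop ℚ) ≤ v (A * (r - s) - B * (r + s)))
    (hy : (y : WithTop ℚ) ≤ v (A * (r + s) - B * (r - s)))
    (hz : (z : WithTop ℚ) ≤ v (A * (r + s) + B * (r - s))) :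
    ((w + x + y + z : ℚ) : WithTop ℚ) ≤ v (d8 (A + B) (A - B) r s) := by
  rw [d8_eq]
  exact le_val_of_le (le_val_mul hw.ge (le_val_mul hx (le_val_mul hy hz))) (by linarith)

theorem exists_val_prefactor (h2 : (2 : F) ≠ 0) (hd : (A + B) * r ≠ (A - B) * s) :
    ∃ w t : ℚ, v (2 * (A * (r - s) + B * (r + s))) = (w : WithTop ℚ) ∧ v 2 = (t : WithTop ℚ) := by
  obtain ⟨t, ht⟩ := exists_val_eq (v := v) h2
  obtain ⟨w, hw⟩ := exists_val_eq (v := v) (x := 2 * (A * (r - s) + B * (r + s)))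
    (mul_ne_zero h2 fun h => hd (by linear_combination h))
  exact ⟨w, t, hw, ht⟩

/-- The case `δ ≥ 2`. -/
theorem not_isTropicallySmooth_of_large (h : IsFirstOrder v A B Q) (h2 : (2 : F) ≠ 0)
    (hd : (A + B) * r ≠ (A - B) * s) (hM : v (r - s) = (m : WithTop ℚ))
    (hP : ((m + 2 : ℚ) : WithTop ℚ) ≤ v (r + s)) :
    ¬ IsTropicallySmooth v (edwardsPoly (A + B) (A - B) r s) := by
  obtain ⟨w, t, hw, ht⟩ := exists_val_prefactor (v := v) h2 hd
  obtain ⟨hz, hy⟩ := h.val_factor_of_far hM hP (by linarith)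
  have k₁ := h.val_d12 hw ht
  have k₂ := h.val_d34 hw ht hz
  have k₃ := h.val_d5 hw ht hM hP (by linarith)
  -- Cancellation in `d₆₇` is possible here. The bound `2m + 2` is half the sum of the reduced
  -- heights `m + 2` and `3m + 2` of `d₃₄` and `d₈`, which is what the long edge requires.
  have k₄ := h.le_val_d67 hw ht hM.ge hP (x := 2 * m + 2) (by linarith) (by linarith) (by linarith)
  have k₅ := val_d8 hw (h.val_factor_of_gt hM hP (by linarith)) hy hz
  refine not_isTropicallySmooth_of_long_edge (coeff_edwardsPoly _ _ _ _) (ne_zero_of_val_eq k₂)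
    (ne_zero_of_val_eq k₃) (ne_zero_of_val_eq k₅) (fun _ => ?_) ?_ (fun h₄ => ?_)
  · rw [realVal_of_eq k₁, realVal_of_eq k₂, realVal_of_eq k₃, realVal_of_eq k₅]
    push_cast
    constructor <;> linarith
  · rw [realVal_of_eq k₂, realVal_of_eq k₃]
    push_cast
    linarith
  · have := le_realVal h₄ k₄
    rw [realVal_of_eq k₂, realVal_of_eq k₃, realVal_of_eq k₅]
    push_cast at this ⊢
    constructor <;> linarith

/-- The case `1 < δ < 2`. -/
theorem isTropicallySmooth_of_between (h : IsFirstOrder v A B Q) (h2 : (2 : F) ≠ 0)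
    (hd : (A + B) * r ≠ (A - B) * s) (hM : v (r - s) = (m : WithTop ℚ))
    (hP : v (r + s) = (p : WithTop ℚ)) (h₁ : m + 1 < p) (h₂ : p < m + 2) :
    IsTropicallySmooth v (edwardsPoly (A + B) (A - B) r s) := by
  obtain ⟨w, t, hw, ht⟩ := exists_val_prefactor (v := v) h2 hd
  obtain ⟨hz, hy⟩ := h.val_factor_of_far hM hP.ge h₁
  have k₁ := h.val_d12 hw ht
  have k₂ := h.val_d34 hw ht hz
  have k₃ := h.val_d5 hw ht hM hP.ge (by linarith)
  have k₄ := h.val_d67 hw ht hM hP (by linarith) (by linarith)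
  have k₅ := val_d8 hw (h.val_factor_of_gt hM hP.ge (by linarith)) hy hz
  have h₁' : (m : ℝ) + 1 < p := by exact_mod_cast h₁
  have h₂' : (p : ℝ) < m + 2 := by exact_mod_cast h₂
  refine isTropicallySmooth_of_star (coeff_edwardsPoly _ _ _ _) (ne_zero_of_val_eq k₁)
    (ne_zero_of_val_eq k₂) (ne_zero_of_val_eq k₃) (ne_zero_of_val_eq k₄) (ne_zero_of_val_eq k₅)
    ?_ ?_ ?_ <;>
  simp only [realVal_of_eq k₁, realVal_of_eq k₂, realVal_of_eq k₃, realVal_of_eq k₄,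
    realVal_of_eq k₅] <;> push_cast <;> linarith

/-- The smooth case for `δ = 1`. -/
theorem isTropicallySmooth_of_eq (h : IsFirstOrder v A B Q) (h2 : (2 : F) ≠ 0)
    (hd : (A + B) * r ≠ (A - B) * s) (hM : v (r - s) = (m : WithTop ℚ))
    (hP : v (r + s) = ((m + 1 : ℚ) : WithTop ℚ))
    (hlt : ((m + 1 : ℚ) : WithTop ℚ) < v (A * (r + s) + B * (r - s))) :
    IsTropicallySmooth v (edwardsPoly (A + B) (A - B) r s) := by
  obtain ⟨w, t, hw, ht⟩ := exists_val_prefactor (v := v) h2 hd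
  have k₁ := h.val_d12 hw ht
  have k₃ := h.val_d5 hw ht hM hP.ge (by linarith)
  have k₄ := h.val_d67 hw ht hM hP (by linarith) (by linarith)
  -- `AP + BM` may vanish, and then `d₃₄` and `d₈` vanish with it; their conditions are needed only
  -- otherwise.
  have hz : A * (r + s) + B * (r - s) ≠ 0 →
      ∃ z : ℚ, v (A * (r + s) + B * (r - s)) = (z : WithTop ℚ) ∧ (m : ℝ) + 1 < z := by
    intro h0
    obtain ⟨z, hz⟩ := exists_val_eq (v := v) h0
    rw [hz, WithTop.coe_lt_coe] at hlt
    exact ⟨z, hz, by exact_mod_cast hlt⟩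
  refine isTropicallySmooth_of_outer_diagonals (coeff_edwardsPoly _ _ _ _) (ne_zero_of_val_eq k₁)
    (ne_zero_of_val_eq k₃) (ne_zero_of_val_eq k₄) ?_ (fun h0 => ?_) (fun h0 => ?_)
  · rw [realVal_of_eq k₁, realVal_of_eq k₃, realVal_of_eq k₄]
    push_cast
    linarith
  · obtain ⟨z, hz, hlt⟩ := hz fun e => h0 (by rw [d34_eq, e]; ring)
    rw [realVal_of_eq k₁, realVal_of_eq k₃, realVal_of_eq k₄, realVal_of_eq (h.val_d34 hw ht hz)]
    push_cast
    linarith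
  · obtain ⟨z, hz, hlt⟩ := hz fun e => h0 (by rw [d8_eq, e]; ring)
    -- Only a lower bound: `AP - BM` differs from `AP + BM` by `2BM`, so its valuation can exceed `m
    -- + 1` when `2` is not a unit.
    have hy : ((m + 1 : ℚ) : WithTop ℚ) ≤ v (A * (r + s) - B * (r - s)) :=
      AddValuation.map_le_sub v (le_val_of_le (val_mul_eq h.val_fst hP).ge (by linarith))
        (le_val_of_le (val_mul_eq h.val_snd hM).ge (by linarith))
    have := le_realVal h0 (le_val_d8 hw (h.val_factor_of_gt hM hP.ge (by linarith)).ge hy hz.ge)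
    rw [realVal_of_eq k₃, realVal_of_eq k₄]
    push_cast at this ⊢
    linarith

/-- The non-smooth cases with `-1 < δ ≤ 1`. -/
theorem not_isTropicallySmooth_of_middle (h : IsFirstOrder v A B Q) (h2 : (2 : F) ≠ 0)
    (hd : (A + B) * r ≠ (A - B) * s) (hM : v (r - s) = (m : WithTop ℚ))
    (hP : v (r + s) = (p : WithTop ℚ)) (h₁ : m < p + 1) (h₂ : p ≤ m + 1)
    (hz : v (A * (r + s) + B * (r - s)) = (p : WithTop ℚ)) :
    ¬ IsTropicallySmooth v (edwardsPoly (A + B) (A - B) r s) := by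
  obtain ⟨w, t, hw, ht⟩ := exists_val_prefactor (v := v) h2 hd
  have k₁ := h.val_d12 hw ht
  have k₂ := h.val_d34 hw ht hz
  have k₃ := h.val_d5 hw ht hM hP.ge (by linarith)
  have k₄ := h.val_d67 hw ht hM hP (by linarith) (by linarith)
  have hy : (p : WithTop ℚ) ≤ v (A * (r + s) - B * (r - s)) :=
    AddValuation.map_le_sub v (le_val_of_le (val_mul_eq h.val_fst hP).ge (by linarith))
      (le_val_of_le (val_mul_eq h.val_snd hM).ge (by linarith))
  have k₅ := le_val_d8 hw (h.val_factor_of_gt hM hP.ge h₁).ge hy hz.ge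
  have h₁' : (m : ℝ) < p + 1 := by exact_mod_cast h₁
  refine not_isTropicallySmooth_of_square (coeff_edwardsPoly _ _ _ _) (ne_zero_of_val_eq k₁)
    (ne_zero_of_val_eq k₂) (ne_zero_of_val_eq k₃) (ne_zero_of_val_eq k₄) ?_ ?_ (fun h0 => ?_)
  · rw [realVal_of_eq k₁, realVal_of_eq k₂, realVal_of_eq k₃, realVal_of_eq k₄]
    push_cast
    linarith
  · rw [realVal_of_eq k₁, realVal_of_eq k₃, realVal_of_eq k₄]
    push_cast
    linarith
  · have := le_realVal h0 k₅
    rw [realVal_of_eq k₁, realVal_of_eq k₃, realVal_of_eq k₄]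
    push_cast at this ⊢
    linarith

/-- The case `δ ≤ -1`. -/
theorem not_isTropicallySmooth_of_small (h : IsFirstOrder v A B Q) (h2 : (2 : F) ≠ 0)
    (hd : (A + B) * r ≠ (A - B) * s) (hP : v (r + s) = (p : WithTop ℚ))
    (hM : ((p + 1 : ℚ) : WithTop ℚ) ≤ v (r - s)) :
    ¬ IsTropicallySmooth v (edwardsPoly (A + B) (A - B) r s) := by
  obtain ⟨w, t, hw, ht⟩ := exists_val_prefactor (v := v) h2 hd
  obtain ⟨hz, hy⟩ := h.val_factor_of_lt hM hP (by linarith)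
  have hx : ((p + 1 : ℚ) : WithTop ℚ) ≤ v (A * (r - s) - B * (r + s)) :=
    AddValuation.map_le_sub v (le_val_of_le (le_val_mul h.val_fst.ge hM) (by linarith))
      (le_val_of_le (val_mul_eq h.val_snd hP).ge (by linarith))
  have k₁ := h.val_d12 hw ht
  have k₂ := h.val_d34 hw ht hz
  have k₃ := h.le_val_d5 hw ht hM hP.ge
  have k₄ := h.le_val_d67 hw ht hM hP.ge (x := 1 + 2 * p) le_rfl (by linarith) (by linarith)
  have k₅ := le_val_d8 hw hx hy.ge hz.ge
  refine not_isTropicallySmooth_of_trapezoid (coeff_edwardsPoly _ _ _ _) (ne_zero_of_val_eq k₁)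
    (ne_zero_of_val_eq k₂) (fun h0 => ?_) (fun h0 => ?_) (fun h0 => ?_)
  · have := le_realVal h0 k₃
    rw [realVal_of_eq k₂]
    push_cast at this ⊢
    linarith
  · have := le_realVal h0 k₄
    rw [realVal_of_eq k₁, realVal_of_eq k₂]
    push_cast at this ⊢
    linarith
  · have := le_realVal h0 k₅
    rw [realVal_of_eq k₁, realVal_of_eq k₂]
    push_cast at this ⊢
    linarith

end IsFirstOrder

end Valuations

/-! ### The criterion at `δ = 1` and the full classification -/

section DeltaOne

variable {F : Type*} [Field F] {v : AddValuation F (WithTop ℚ)} {A B Q r s : F} {m p : ℚ}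

/-- Replacing `A, B` by `1, Q` changes `AP + BM` by a term of valuation at least `m + 2`, which does
not affect the inequality. With `P = QM(-1 + κ)` one has `P + QM = QMκ`, and `v(QM) = m + 1`. -/
theorem lt_val_factor_iff (h : IsFirstOrder v A B Q) (hM : v (r - s) = (m : WithTop ℚ))
    (hP : v (r + s) = ((m + 1 : ℚ) : WithTop ℚ)) :
    ((m + 1 : ℚ) : WithTop ℚ) < v (A * (r + s) + B * (r - s)) ↔
      ∃ κ : F, 0 < v κ ∧ r + s = Q * (r - s) * (-1 + κ) := by
  have hQM : v (Q * (r - s)) = ((m + 1 : ℚ) : WithTop ℚ) := by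
    rw [val_mul_eq h.val_param hM, add_comm]
  have hrem : ((m + 1 : ℚ) : WithTop ℚ) < v ((A - 1) * (r + s) + (B - Q) * (r - s)) :=
    lt_of_lt_of_le (WithTop.coe_lt_coe.2 (by linarith : m + 1 < m + 2))
      (AddValuation.map_le_add v (le_val_of_le (le_val_mul h.val_sub_one hP.ge) (by linarith))
        (le_val_of_le (le_val_mul h.val_sub hM.ge) (by linarith)))
  have key : ∀ κ : F, r + s = Q * (r - s) * (-1 + κ) →
      (((m + 1 : ℚ) : WithTop ℚ) < v (r + s + Q * (r - s)) ↔ 0 < v κ) := by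
    intro κ hκ
    have e : r + s + Q * (r - s) = Q * (r - s) * κ := by linear_combination hκ
    rw [e, AddValuation.map_mul, hQM]
    constructor
    · intro hlt
      by_contra hle
      exact absurd hlt (not_lt.2 (by simpa using add_le_add_right (not_lt.1 hle) _))
    · intro hpos
      have hlt := WithTop.add_lt_add_left (WithTop.coe_ne_top (a := m + 1)) hpos
      rwa [add_zero] at hlt
  have hiff : ((m + 1 : ℚ) : WithTop ℚ) < v (A * (r + s) + B * (r - s)) ↔
      ((m + 1 : ℚ) : WithTop ℚ) < v (r + s + Q * (r - s)) := by
    constructor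
    · intro hlt
      have e : r + s + Q * (r - s) = A * (r + s) + B * (r - s) -
        ((A - 1) * (r + s) + (B - Q) * (r - s)) := by ring
      rw [e, sub_eq_add_neg]
      exact AddValuation.map_lt_add v hlt (by rwa [AddValuation.map_neg])
    · intro hlt
      have e : A * (r + s) + B * (r - s) = r + s + Q * (r - s) +
        ((A - 1) * (r + s) + (B - Q) * (r - s)) := by ring
      rw [e]
      exact AddValuation.map_lt_add v hlt hrem
  rw [hiff]
  constructor
  · intro hlt
    have e : r + s = Q * (r - s) * (-1 + ((r + s) / (Q * (r - s)) + 1)) := by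
      rw [neg_add_cancel_comm_assoc, mul_div_cancel₀ _ (ne_zero_of_val_eq hQM)]
    exact ⟨_, (key _ e).1 hlt, e⟩
  · rintro ⟨κ, hκ, e⟩
    exact (key κ e).2 hκ

theorem isTropicallySmooth_iff_of_eq (h : IsFirstOrder v A B Q) (h2 : (2 : F) ≠ 0)
    (hd : (A + B) * r ≠ (A - B) * s) (hM : v (r - s) = (m : WithTop ℚ))
    (hP : v (r + s) = ((m + 1 : ℚ) : WithTop ℚ)) :
    IsTropicallySmooth v (edwardsPoly (A + B) (A - B) r s) ↔
      ∃ κ : F, 0 < v κ ∧ r + s = Q * (r - s) * (-1 + κ) := by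
  rw [← lt_val_factor_iff h hM hP]
  refine ⟨fun hs => ?_, h.isTropicallySmooth_of_eq h2 hd hM hP⟩
  by_contra hlt
  have hle : ((m + 1 : ℚ) : WithTop ℚ) ≤ v (A * (r + s) + B * (r - s)) :=
    AddValuation.map_le_add v (le_val_of_le (val_mul_eq h.val_fst hP).ge (by linarith))
      (le_val_of_le (val_mul_eq h.val_snd hM).ge (by linarith))
  exact h.not_isTropicallySmooth_of_middle h2 hd hM hP (by linarith) le_rfl
    (le_antisymm (not_lt.1 hlt) hle) hs

/-- Reformulation of the criterion in terms of principal coefficients. -/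
theorem exists_principal_coefficient_iff {w : F} (h2 : v 2 = 0) (hM0 : r - s ≠ 0)
    (hw : ∃ κ' : F, 0 < v κ' ∧ r - s = w * (2 + κ')) :
    (∃ κ : F, 0 < v κ ∧ r + s = Q * (r - s) * (-1 + κ)) ↔
      ∃ κ : F, 0 < v κ ∧ r + s = Q * w * (-2 + κ) := by
  obtain ⟨κ', hκ', e'⟩ := hw
  have h2κ : v (2 + κ') = 0 := by
    rw [AddValuation.map_add_eq_of_lt_left _ (h2 ▸ hκ'), h2]
  have h0 : 2 + κ' ≠ 0 := fun h => hM0 (by rw [e', h, mul_zero])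
  constructor
  · rintro ⟨κ, hκ, e⟩
    -- Read off from `(2 + κ')(-1 + κ) = -2 + (κ(2 + κ') - κ')`; the converse solves this for `κ`,
    -- which is possible because `2 + κ'` is a unit.
    refine ⟨κ * (2 + κ') + -κ', AddValuation.map_lt_add v ?_ ?_, by rw [e, e']; ring⟩
    · rwa [AddValuation.map_mul, h2κ, add_zero]
    · rwa [AddValuation.map_neg]
  · rintro ⟨κ, hκ, e⟩
    refine ⟨(κ + κ') / (2 + κ'), ?_, ?_⟩
    · have h := AddValuation.map_lt_add v hκ hκ'
      rwa [← div_mul_cancel₀ (κ + κ') h0, AddValuation.map_mul, h2κ, add_zero] at h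
    · rw [e, e']
      field_simp
      ring

theorem delta_cases (h0 : r - s ≠ 0 ∨ r + s ≠ 0) :
    (∃ m p : ℚ, v (r - s) = (m : WithTop ℚ) ∧ v (r + s) = (p : WithTop ℚ) ∧
      delta v r s = (((p - m : ℚ) : ℝ) : EReal)) ∨
    (∃ m : ℚ, v (r - s) = (m : WithTop ℚ) ∧ v (r + s) = ⊤ ∧ delta v r s = ⊤) ∨
    (∃ p : ℚ, v (r - s) = ⊤ ∧ v (r + s) = (p : WithTop ℚ) ∧ delta v r s = ⊥) := by
  have top : toEReal ⊤ = ⊤ := rfl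
  have coe : ∀ x : ℚ, toEReal (x : WithTop ℚ) = ((x : ℝ) : EReal) := fun _ => rfl
  by_cases hM : r - s = 0
  · obtain ⟨p, hp⟩ := exists_val_eq (v := v) (h0.resolve_left (not_not.2 hM))
    have hM' : v (r - s) = ⊤ := (AddValuation.top_iff v).2 hM
    exact Or.inr (Or.inr ⟨p, hM', hp, by rw [delta, hp, hM', top, coe, EReal.sub_top]⟩)
  · obtain ⟨m, hm⟩ := exists_val_eq (v := v) hM
    by_cases hP : r + s = 0
    · have hP' : v (r + s) = ⊤ := (AddValuation.top_iff v).2 hP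
      exact Or.inr (Or.inl ⟨m, hm, hP', by rw [delta, hm, hP', top, coe, EReal.top_sub_coe]⟩)
    · obtain ⟨p, hp⟩ := exists_val_eq (v := v) hP
      refine Or.inl ⟨m, p, hm, hp, ?_⟩
      rw [delta, hm, hp, coe, coe]
      push_cast
      rfl

/-- The classification of smooth curves in terms of `δ`, away from `δ = 1`. -/
theorem IsFirstOrder.isTropicallySmooth_of_delta (h : IsFirstOrder v A B Q) (h2 : (2 : F) ≠ 0)
    (hd : (A + B) * r ≠ (A - B) * s) :
    (2 ≤ delta v r s → ¬ IsTropicallySmooth v (edwardsPoly (A + B) (A - B) r s)) ∧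
    (1 < delta v r s → delta v r s < 2 →
      IsTropicallySmooth v (edwardsPoly (A + B) (A - B) r s)) ∧
    (delta v r s = 1 → (IsTropicallySmooth v (edwardsPoly (A + B) (A - B) r s) ↔
      ∃ κ : F, 0 < v κ ∧ r + s = Q * (r - s) * (-1 + κ))) ∧
    (delta v r s < 1 → ¬ IsTropicallySmooth v (edwardsPoly (A + B) (A - B) r s)) := by
  -- This excludes the indeterminate difference `∞ - ∞` in `δ`.
  have h0 : r - s ≠ 0 ∨ r + s ≠ 0 := by
    by_contra! hc
    have hr : r = 0 := mul_left_cancel₀ h2 (by linear_combination hc.1 + hc.2)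
    have hs : s = 0 := mul_left_cancel₀ h2 (by linear_combination hc.2 - hc.1)
    exact hd (by rw [hr, hs, mul_zero, mul_zero])
  rcases delta_cases (v := v) h0 with ⟨m, p, hM, hP, hδ⟩ | ⟨m, hM, hP, hδ⟩ | ⟨p, hM, hP, hδ⟩
  · rw [hδ]
    have two : (2 : EReal) = (((2 : ℚ) : ℝ) : EReal) := by rw [Rat.cast_ofNat]; rfl
    have one : (1 : EReal) = (((1 : ℚ) : ℝ) : EReal) := by norm_num
    rw [one, two]
    simp only [EReal.coe_le_coe_iff, EReal.coe_lt_coe_iff, EReal.coe_eq_coe_iff, Rat.cast_le,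
      Rat.cast_lt, Rat.cast_inj]
    refine ⟨fun hp => ?_, fun hp₁ hp₂ => ?_, fun hp => ?_, fun hp => ?_⟩
    · exact h.not_isTropicallySmooth_of_large h2 hd hM (le_val_of_le hP.ge (by linarith))
    · exact h.isTropicallySmooth_of_between h2 hd hM hP (by linarith) (by linarith)
    · obtain rfl : p = m + 1 := by linarith
      exact isTropicallySmooth_iff_of_eq h h2 hd hM hP
    · rcases le_or_gt m (p + 1) with hmp | hmp
      · rcases hmp.lt_or_eq with hmp | rfl
        · exact h.not_isTropicallySmooth_of_middle h2 hd hM hP hmp (by linarith)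
            (h.val_factor_of_lt hM.ge hP (by linarith)).1
        · exact h.not_isTropicallySmooth_of_small h2 hd hP hM.ge
      · exact h.not_isTropicallySmooth_of_small h2 hd hP (le_val_of_le hM.ge hmp.le)
  · rw [hδ]
    have e : (⊤ : EReal) ≠ 1 := (EReal.coe_ne_top 1).symm
    refine ⟨fun _ => h.not_isTropicallySmooth_of_large h2 hd hM (hP ▸ le_top),
      fun _ hc => absurd hc not_top_lt, fun hc => absurd hc e, fun hc => absurd hc not_top_lt⟩
  · rw [hδ]
    have e : (⊥ : EReal) ≠ 1 := (EReal.coe_ne_bot 1).symm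
    refine ⟨fun hc => absurd (le_bot_iff.1 hc) (EReal.coe_ne_bot 2), fun hc => absurd hc not_lt_bot,
      fun hc => absurd hc e, fun _ => h.not_isTropicallySmooth_of_small h2 hd hP (hM ▸ le_top)⟩

/-- Parameters with `r - s = 1` and `r + s = Q u` for a unit `u`. -/
theorem exists_parameters (h : IsFirstOrder v A B Q) (h2 : (2 : F) ≠ 0) {u : F} (hu : v u = 0) :
    ∃ r s : F, (A + B) * r ≠ (A - B) * s ∧ delta v r s = 1 ∧ r - s = 1 ∧ r + s = Q * u := by
  have hM : (Q * u + 1) / 2 - (Q * u - 1) / 2 = 1 := by field_simp; ring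
  have hP : (Q * u + 1) / 2 + (Q * u - 1) / 2 = Q * u := by field_simp; ring
  have hQu : v (Q * u) = ((1 : ℚ) : WithTop ℚ) := by
    simpa using val_mul_eq h.val_param (b := 0) hu
  refine ⟨_, _, fun he => ?_, ?_, hM, hP⟩
  · have h0 := h.val_factor_add_of_gt (M := 1) (m := 0) (AddValuation.map_one v) hQu.ge
      (by norm_num)
    refine ne_zero_of_val_eq h0 ?_
    linear_combination he - A * hM - B * hP
  · rw [delta, hM, hP, hQu, AddValuation.map_one]
    change (((1 : ℚ) : ℝ) : EReal) - (((0 : ℚ) : ℝ) : EReal) = 1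
    norm_num

/-- A primitive cube root of unity is a unit whose successor is a unit as well. -/
theorem exists_unit_add_one_unit [IsAlgClosed F] (v : AddValuation F (WithTop ℚ)) :
    ∃ u : F, v u = 0 ∧ v (u + 1) = 0 := by
  -- The choice works in every residue characteristic. If the residue field of `K` is `𝔽₂`, no
  -- element of `K` would do, since a unit is then congruent to `-1`.
  obtain ⟨u, hu⟩ := IsAlgClosed.exists_root (Polynomial.X ^ 2 + Polynomial.X + 1 : Polynomial F)
    (by
      have : (Polynomial.X ^ 2 + Polynomial.X + 1 : Polynomial F).degree = 2 := by compute_degree!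
      rw [this]; decide)
  have hu : u ^ 2 + u + 1 = 0 := by simpa [Polynomial.IsRoot] using hu
  have hu0 : u ≠ 0 := by
    rintro rfl
    simp at hu
  have hvu : v u = 0 := by
    obtain ⟨a, ha⟩ := exists_val_eq (v := v) hu0
    have h3 : v (u * (u * u)) = ((0 : ℚ) : WithTop ℚ) := by
      have : u * (u * u) = 1 := by linear_combination (u - 1) * hu
      rw [this]
      exact AddValuation.map_one v
    rw [val_mul_eq ha (val_mul_eq ha ha), WithTop.coe_inj] at h3
    have : a = 0 := by linarith
    rw [ha, this]
    rfl
  refine ⟨u, hvu, ?_⟩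
  have e : u + 1 = -(u * u) := by linear_combination hu
  rw [e, AddValuation.map_neg, AddValuation.map_mul, hvu, add_zero]

end DeltaOne

/-! ### Transfer of the first-order estimates to the algebraic closure -/

section Extension

variable {K L : Type*} [Field K] [Valued K ℤᵐ⁰] [Field L] [Algebra K L] {q : K}
  {v : AddValuation L (WithTop ℚ)}

theorem le_val_algebraMap (hq0 : q ≠ 0) (hq1 : Valued.v q < 1) (hv : ExtendsNormalized q v)
    {x : K} {k : ℕ} (hx : Valued.v x ≤ Valued.v (q ^ k)) :
    ((k : ℚ) : WithTop ℚ) ≤ v (algebraMap K L x) := by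
  rcases eq_or_ne x 0 with rfl | hx0
  · simp
  have hvq : Valued.v q ≠ 0 := (Valuation.ne_zero_iff _).2 hq0
  have hvx : Valued.v x ≠ 0 := (Valuation.ne_zero_iff _).2 hx0
  have hlq : WithZero.log (Valued.v q) < 0 := by
    simpa using (WithZero.log_lt_log hvq one_ne_zero).2 hq1
  have hlx : WithZero.log (Valued.v x) ≤ k * WithZero.log (Valued.v q) := by
    have := (WithZero.log_le_log hvx ((Valuation.ne_zero_iff _).2 (pow_ne_zero k hq0))).2 hx
    simpa [map_pow, WithZero.log_pow] using this
  rw [hv x hx0, WithTop.coe_le_coe, le_div_iff₀ (by exact_mod_cast neg_pos.2 hlq)]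
  have : (k : ℤ) * -WithZero.log (Valued.v q) ≤ -WithZero.log (Valued.v x) := by linarith
  exact_mod_cast this

theorem val_algebraMap_self (hq0 : q ≠ 0) (hq1 : Valued.v q < 1) (hv : ExtendsNormalized q v) :
    v (algebraMap K L q) = ((1 : ℚ) : WithTop ℚ) := by
  have hlq : WithZero.log (Valued.v q) < 0 := by
    simpa using (WithZero.log_lt_log ((Valuation.ne_zero_iff _).2 hq0) one_ne_zero).2 hq1
  rw [hv q hq0, div_self]
  exact_mod_cast (neg_pos.2 hlq).ne'

/-- The even and odd parts of `ε(q)` in the extension `L`. -/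
theorem exists_isFirstOrder [CharZero K] [CompleteSpace K] (hq0 : q ≠ 0) (hq1 : Valued.v q < 1)
    (hv : ExtendsNormalized q v) :
    ∃ A B : L, IsFirstOrder v A B (algebraMap K L q) ∧
      algebraMap K L (eulerProd q) = A + B ∧ algebraMap K L (eulerProd (-q)) = A - B := by
  obtain ⟨a, b, ha, hb, h₁, h₂⟩ := exists_eulerProd_eq hq0 hq1
  refine ⟨algebraMap K L a, algebraMap K L b, ⟨?_, ?_, val_algebraMap_self hq0 hq1 hv⟩,
    by rw [h₁, map_add], by rw [h₂, map_sub]⟩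
  · rw [← map_one (algebraMap K L), ← map_sub]
    exact_mod_cast le_val_algebraMap hq0 hq1 hv (k := 1) (by rwa [pow_one])
  · rw [← map_sub]
    exact_mod_cast le_val_algebraMap hq0 hq1 hv (k := 2) hb

end Extension

end TropicalEdwards

end

/-! ### The main theorem -/

open TropicalEdwards in
theorem proposition1p4 {K L : Type*} [Field K] [CharZero K] [Valued K ℤᵐ⁰] [CompleteSpace K]
    (hK : Function.Surjective (Valued.v : Valuation K ℤᵐ⁰))
    [Field L] [Algebra K L] [IsAlgClosure K L]
    (q : K) (hq0 : q ≠ 0) (hq1 : Valued.v q < 1)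
    (v : AddValuation L (WithTop ℚ)) (hv : ExtendsNormalized q v) :
    (∀ r s : L, Nondegenerate q r s →
      -- large `δ`: never smooth
      (2 ≤ delta v r s → ¬ IsTropicallySmooth v (curvePoly q r s)) ∧
      -- always smooth
      (1 < delta v r s → delta v r s < 2 → IsTropicallySmooth v (curvePoly q r s)) ∧
      -- the criterion for `δ = 1`, for arbitrary parameters
      (delta v r s = 1 →
        (IsTropicallySmooth v (curvePoly q r s) ↔
          ∃ κ : L, 0 < v κ ∧ r + s = algebraMap K L q * (r - s) * (-1 + κ))) ∧
      -- the criterion for `δ = 1`, when `r - s` has principal coefficient `2` with respect to a power `w` of `q`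
      (delta v r s = 1 → v 2 = 0 → ∀ (w : L) (N : ℕ) (M : ℤ), 0 < N →
        w ^ N = algebraMap K L q ^ M →
        (∃ κ' : L, 0 < v κ' ∧ r - s = w * (2 + κ')) →
        (IsTropicallySmooth v (curvePoly q r s) ↔
          ∃ κ : L, 0 < v κ ∧ r + s = algebraMap K L q * w * (-2 + κ))) ∧
      -- small `δ`: never smooth
      (delta v r s < 1 → ¬ IsTropicallySmooth v (curvePoly q r s))) ∧
    -- both possibilities occur when `δ = 1`
    (∃ r s : L, Nondegenerate q r s ∧ delta v r s = 1 ∧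
      IsTropicallySmooth v (curvePoly q r s)) ∧
    (∃ r s : L, Nondegenerate q r s ∧ delta v r s = 1 ∧
      ¬ IsTropicallySmooth v (curvePoly q r s)) := by
  have : CharZero L := charZero_of_injective_algebraMap (algebraMap K L).injective
  have : IsAlgClosed L := IsAlgClosure.isAlgClosed K
  have h2 : (2 : L) ≠ 0 := two_ne_zero
  obtain ⟨A, B, h, h₁, h₂⟩ := exists_isFirstOrder (L := L) hq0 hq1 hv
  simp only [Nondegenerate, curvePoly, h₁, h₂]
  refine ⟨fun r s hd => ?_, ?_, ?_⟩
  · obtain ⟨c₁, c₂, c₃, c₄⟩ := h.isTropicallySmooth_of_delta (r := r) (s := s) h2 hd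
    refine ⟨c₁, c₂, c₃, fun hδ hv2 w _ _ _ _ hw => ?_, c₄⟩
    rw [c₃ hδ]
    refine exists_principal_coefficient_iff hv2 (fun hM => ?_) hw
    -- If `r - s = 0` then `δ = -∞`, against `δ = 1`.
    have hδ' : delta v r s = ⊥ := by
      rw [delta, hM, AddValuation.map_zero]
      exact EReal.sub_top _
    exact EReal.coe_ne_bot 1 (hδ.symm.trans hδ')
  · obtain ⟨r, s, hd, hδ, hM, hP⟩ := exists_parameters h h2 (u := -1)
      (by rw [AddValuation.map_neg, AddValuation.map_one])
    refine ⟨r, s, hd, hδ, ((h.isTropicallySmooth_of_delta h2 hd).2.2.1 hδ).2 ⟨0, ?_, ?_⟩⟩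
    · rw [AddValuation.map_zero]
      exact WithTop.coe_lt_top 0
    · rw [hP, hM]
      ring
  · obtain ⟨u, hu, hu1⟩ := exists_unit_add_one_unit v
    obtain ⟨r, s, hd, hδ, hM, hP⟩ := exists_parameters h h2 hu
    refine ⟨r, s, hd, hδ, fun hs => ?_⟩
    obtain ⟨κ, hκ, e⟩ := ((h.isTropicallySmooth_of_delta h2 hd).2.2.1 hδ).1 hs
    rw [hP, hM, mul_one] at e
    have hκu : κ = u + 1 := by
      linear_combination -mul_left_cancel₀ (ne_zero_of_val_eq h.val_param) e
    rw [hκu, hu1] at hκ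
    exact lt_irrefl _ hκ
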